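/- For $x>0$ let $$\Gamma_q(x)=(1-q)^{1-x}\prod_{n=0}^\infty\frac{1-q^{n+1}}{1-q^{n+x}}\quad(0<q<1),\qquad \Gamma_q(x)=(q-1)^{1-x}q^{x(x-1)/2}\prod_{n=0}^\infty\frac{1-q^{-(n+1)}}{1-q^{-(n+x)}}\quad(q>1),$$ and let $\Gamma_1=\Gamma$ be the Euler gamma function. For $q>0$ let $\psi_q(x)=\Gamma_q'(x)/\Gamma_q(x)$, where primes denote derivatives in $x$. For $m\in\mathbb{R}$ and $a,b>0$ let $H_m(a,b)=\left(\frac{a^m+b^m}{2}\right)^{1/m}$ if $m\neq0$, and $H_0(a,b)=\sqrt{ab}$. Put $G_{m,q}(x)=H_m\big(\Gamma_q(x),\Gamma_q(1/x)\big)$ for $x>0$. 1. For every $q\ge 1$ and $m\in\mathbb{R}$, the function $G_{m,q}$ is decreasing on $(0,1)$ and increasing on $(1,\infty)$ if and only if $$m\ \ge\ \frac{-\psi_q(1)-\psi_q'(1)}{\psi_q(1)^2}.$$ This equivalence holds both when "decreasing" and "increasing" are understood in the weak sense and when they are understood in the strict sense. 2. For every $q>0$ and every real $m\ge \frac{1}{\psi_q(1)}$,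 the function $G_{m,q}$ is strictly decreasing on $(0,1)$ and strictly increasing on $(1,\infty)$. -/

import Mathlib

noncomputable section

/-- The `q`-gamma function `Γ_q(x)` for real `q > 0` and `x > 0`, with `Γ_1 = Γ`.
Values at other arguments carry no meaning. -/
def qGamma (q x : ℝ) : ℝ :=
  if q < 1 then
    (1 - q) ^ (1 - x) *
      ∏' n : ℕ, (1 - q ^ ((n : ℝ) + 1)) / (1 - q ^ ((n : ℝ) + x))
  else if q = 1 then Real.Gamma x
  else
    (q - 1) ^ (1 - x) * q ^ (x * (x - 1) / 2) *
      ∏' n : ℕ, (1 - q ^ (-((n : ℝ) + 1))) / (1 - q ^ (-((n : ℝ) + x)))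

/-- The `q`-digamma function `ψ_q = Γ_q' / Γ_q`. -/
def qDigamma (q x : ℝ) : ℝ :=
  deriv (qGamma q) x / qGamma q x

/-- The power mean of order `m` of two positive numbers; the mean of order `0` is
the geometric mean. -/
def powerMean (m a b : ℝ) : ℝ :=
  if m = 0 then Real.sqrt (a * b) else ((a ^ m + b ^ m) / 2) ^ (1 / m)

/-- The power mean of order `m` of `Γ_q(x)` and `Γ_q(1/x)`. -/
def qGammaMean (m q x : ℝ) : ℝ :=
  powerMean m (qGamma q x) (qGamma q (1 / x))

end

/-!
Write `g = log Γ_q`, `ψ = g'`. The derivative of the mean `G` of order `m` at `x` is a positive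
multiple of `F x - F (1 / x)`, where `F x = x ψ(x) Γ_q(x) ^ m`, and `G (1 / x) = G x`. So `G`
is monotone as claimed if and only if `F x ≥ F (1 / x)` for `x > 1`. Since both sides agree at
`1`, this forces `F' 1 ≥ 0`, which is the stated lower bound for `m`
(`le_of_monotoneOn_qGammaMean`).

For the converse let `x > 1` and `y = 1 / x`. If `ψ x ≥ 0` then `F x ≥ 0 > F y`. Otherwise
`1 < x < 3 / 2`, because `ψ` is concave and has mean value `0` on `[1, 2]`; both `F x` and `F y`
are negative and one compares logarithms. Differentiating in `log x`, it suffices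
(`log_lt_log_of_forall`) that
`2 + m (x ψ x + y ψ y) < x ψ' x / (-ψ x) + y ψ' y / (-ψ y)`.
Put `a = -ψ 1`, `A = ψ' 1 / a`; convexity of `ψ'` and `g 1 = g 2 = 0` give `A > 2`.

* For `q ≥ 1` and critical `m = (A - 1) / (-a)`, `s² ψ' s` is nondecreasing for `s ≥ 1 / 2`
  (`two_mul_trigamma_add_nonneg`). Integration gives `-ψ s ≤ a (1 + A (1 / s - 1))` on both sides
  of `1`, hence `ψ x ψ y ≤ a² (1 - (A² - A) w)` with `w = x + y - 2`, while log-convexity gives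
  `ψ' x ψ' y ≥ a² A² e ^ (-2 w)`. As `A² - A > 2`, the product of the two terms on the right
  exceeds `A²` and their sum exceeds `2 A`; the left-hand side is at most `2 A`
  (`two_add_lt_of_inverse_square`).
* For `q < 1` and `m = 1 / ψ 1`, the left-hand side may be much larger than its value at `1`. Here
  `ψ'` is compared with exponentials, using `A ≥ 12 / 5`, and
  `A ≥ 2 l coth l` with `l = |log q| / 2`, improved by `1 / 2` for large `l`
  (`two_add_lt_of_moderate`, `two_add_lt_of_large`).
* For `q ≥ 1` the exponent `1 / ψ 1` is at least the critical one, again by `A > 2`.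

All values of `q` are treated together through the expansion (`qGamma_eq_exp`)
`g x = c (x - 1) (x - 2) / 2 + ∑ (log S(n + 1) - log S(n + x) + (x - 1) log (S(n + 2) / S(n + 1)))`
with `S z = sinh (l z) / l` (`S z = z` if `q = 1`) and `c = max (log q) 0`. It follows that
`ψ' x = c + ∑ 1 / S(n + x)²`.
-/

/-! ### The hyperbolic kernel -/

namespace QGamma

open Real

/-- `sinh (l z) / l`, continued by `z` at `l = 0`. -/
noncomputable def scaledSinh (l z : ℝ) : ℝ := if l = 0 then z else sinh (l * z) / l

/-- The kernel `(l / sinh (l z)) ^ 2`, equal to `1 / z ^ 2` at `l = 0`. -/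
noncomputable def kernel (l z : ℝ) : ℝ := 1 / scaledSinh l z ^ 2

/-- `l * coth (l z)`, the logarithmic derivative of `scaledSinh l`; equal to `1 / z` at `l = 0`. -/
noncomputable def scaledCoth (l z : ℝ) : ℝ := cosh (l * z) / scaledSinh l z

/-- The derivative of `kernel l`. -/
noncomputable def kernelDeriv (l z : ℝ) : ℝ := -2 * scaledCoth l z * kernel l z

lemma mul_scaledSinh (l z : ℝ) : l * scaledSinh l z = sinh (l * z) := by
  unfold scaledSinh
  split_ifs with h
  · simp [h]
  · field_simp

@[simp]
lemma scaledSinh_zero (l : ℝ) : scaledSinh l 0 = 0 := by simp [scaledSinh]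

lemma hasDerivAt_scaledSinh (l z : ℝ) :
    HasDerivAt (scaledSinh l) (cosh (l * z)) z := by
  by_cases h : l = 0
  · have : scaledSinh l = fun z => z := by funext w; simp [scaledSinh, h]
    rw [this, h]
    simpa using hasDerivAt_id' z
  · have : scaledSinh l = fun z => sinh (l * z) / l := by funext w; simp [scaledSinh, h]
    rw [this]
    have h1 : HasDerivAt (fun z : ℝ => l * z) l z := by
      simpa using (hasDerivAt_id' z).const_mul l
    have h2 := (h1.sinh).div_const l
    refine h2.congr_deriv ?_
    field_simp

lemma le_scaledSinh {l z : ℝ} (hl : 0 ≤ l) (hz : 0 ≤ z) : z ≤ scaledSinh l z := by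
  rcases hl.eq_or_lt with h | h
  · simp [scaledSinh, ← h]
  · rw [scaledSinh, if_neg h.ne', le_div_iff₀ h, mul_comm]
    exact self_le_sinh_iff.2 (by positivity)

lemma scaledSinh_pos {l z : ℝ} (hl : 0 ≤ l) (hz : 0 < z) : 0 < scaledSinh l z :=
  hz.trans_le (le_scaledSinh hl hz.le)

lemma kernel_pos {l z : ℝ} (hl : 0 ≤ l) (hz : 0 < z) : 0 < kernel l z := by
  have := scaledSinh_pos hl hz
  unfold kernel; positivity

lemma scaledCoth_pos {l z : ℝ} (hl : 0 ≤ l) (hz : 0 < z) : 0 < scaledCoth l z :=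
  div_pos (cosh_pos _) (scaledSinh_pos hl hz)

lemma kernel_le {l z : ℝ} (hl : 0 ≤ l) (hz : 0 < z) : kernel l z ≤ 1 / z ^ 2 := by
  have := le_scaledSinh hl hz.le
  unfold kernel
  gcongr

lemma cosh_sq_eq (l z : ℝ) : cosh (l * z) ^ 2 = 1 + l ^ 2 * scaledSinh l z ^ 2 := by
  rw [cosh_sq, ← mul_scaledSinh]; ring

lemma hasDerivAt_scaledCoth {l z : ℝ} (hl : 0 ≤ l) (hz : 0 < z) :
    HasDerivAt (scaledCoth l) (-kernel l z) z := by
  have hS := scaledSinh_pos hl hz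
  have h1 : HasDerivAt (fun z : ℝ => l * z) l z := by
    simpa using (hasDerivAt_id' z).const_mul l
  have h := (h1.cosh).div (hasDerivAt_scaledSinh l z) hS.ne'
  refine h.congr_deriv ?_
  rw [kernel, ← neg_div, div_left_inj' (by positivity), ← mul_scaledSinh]
  linear_combination -cosh_sq_eq l z

lemma hasDerivAt_log_scaledSinh {l z : ℝ} (hl : 0 ≤ l) (hz : 0 < z) :
    HasDerivAt (fun z => log (scaledSinh l z)) (scaledCoth l z) z :=
  (hasDerivAt_scaledSinh l z).log (scaledSinh_pos hl hz).ne'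

lemma hasDerivAt_kernel {l z : ℝ} (hl : 0 ≤ l) (hz : 0 < z) :
    HasDerivAt (kernel l) (kernelDeriv l z) z := by
  have hS := scaledSinh_pos hl hz
  have h := ((hasDerivAt_scaledSinh l z).pow 2).inv (pow_ne_zero 2 hS.ne')
  have e : kernel l = (scaledSinh l ^ 2)⁻¹ := by
    funext w; simp [kernel]
  rw [e]
  refine h.congr_deriv ?_
  simp only [kernelDeriv, scaledCoth, kernel, Pi.pow_apply]
  field_simp
  norm_num
  ring

/-- `sinh u ≤ u e ^ u` for every real `u`. -/
lemma sinh_le_mul_exp (u : ℝ) : sinh u ≤ u * exp u := by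
  have h : 1 - 2 * u ≤ exp (-(2 * u)) := by linarith [add_one_le_exp (-(2 * u))]
  have h2 : exp (-u) = exp u * exp (-(2 * u)) := by rw [← exp_add]; ring_nf
  rw [sinh_eq, h2]
  nlinarith [exp_pos u, mul_le_mul_of_nonneg_left h (exp_pos u).le]

lemma le_scaledCoth {l z : ℝ} (hl : 0 ≤ l) (hz : 0 < z) : l ≤ scaledCoth l z := by
  rw [scaledCoth, le_div_iff₀ (scaledSinh_pos hl hz), mul_scaledSinh]
  exact (sinh_lt_cosh _).le

lemma inv_le_scaledCoth {l z : ℝ} (hl : 0 ≤ l) (hz : 0 < z) : 1 / z ≤ scaledCoth l z := by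
  have hS := scaledSinh_pos hl hz
  rw [scaledCoth, div_le_div_iff₀ hz hS, one_mul]
  -- `z cosh (l z) - sinh (l z) / l` vanishes at `0` and has derivative `l z sinh (l z) ≥ 0`
  have hd : ∀ w : ℝ, HasDerivAt (fun w => w * cosh (l * w) - scaledSinh l w)
      (w * (sinh (l * w) * l)) w := by
    intro w
    have h1 : HasDerivAt (fun z : ℝ => l * z) l w := by
      simpa using (hasDerivAt_id' w).const_mul l
    have := ((hasDerivAt_id' w).mul h1.cosh).sub (hasDerivAt_scaledSinh l w)
    refine this.congr_deriv ?_
    ring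
  have hm : MonotoneOn (fun w => w * cosh (l * w) - scaledSinh l w) (Set.Ici 0) := by
    refine monotoneOn_of_hasDerivWithinAt_nonneg (convex_Ici 0)
      (fun w _ => (hd w).continuousAt.continuousWithinAt) (fun w _ => (hd w).hasDerivWithinAt) ?_
    intro w hw
    rw [interior_Ici] at hw
    have hw' : (0 : ℝ) < w := hw
    have : 0 ≤ sinh (l * w) := sinh_nonneg_iff.2 (by positivity)
    positivity
  have := hm (Set.mem_Ici.2 le_rfl) (Set.mem_Ici.2 hz.le) hz.le
  simp only [scaledSinh_zero, zero_mul, sub_zero] at this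
  linarith

lemma scaledCoth_le {l z : ℝ} (hl : 0 ≤ l) (hz : 0 < z) : scaledCoth l z ≤ l + 1 / z := by
  have hS := scaledSinh_pos hl hz
  rcases hl.eq_or_lt with h | h
  · simp [scaledCoth, scaledSinh, ← h]
  rw [scaledCoth, div_le_iff₀ hS]
  have h1 : (l * z) * exp (-(l * z)) ≤ sinh (l * z) := by
    have := sinh_le_mul_exp (-(l * z))
    rw [sinh_neg] at this
    linarith
  rw [← cosh_sub_sinh, ← mul_scaledSinh l z] at h1
  have h2 : z * cosh (l * z) ≤ scaledSinh l z + z * (l * scaledSinh l z) := by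
    have : l * (z * cosh (l * z)) ≤ l * (scaledSinh l z + z * (l * scaledSinh l z)) := by
      nlinarith
    exact le_of_mul_le_mul_left this h
  have h3 : (l + 1 / z) * scaledSinh l z =
      (scaledSinh l z + z * (l * scaledSinh l z)) / z := by field_simp; ring
  rw [h3, le_div_iff₀ hz]
  linarith

lemma scaledCoth_antitoneOn {l : ℝ} (hl : 0 ≤ l) :
    AntitoneOn (scaledCoth l) (Set.Ioi 0) := by
  refine antitoneOn_of_hasDerivWithinAt_nonpos (f' := fun z => -kernel l z) (convex_Ioi 0)
    (fun z hz => (hasDerivAt_scaledCoth hl hz).continuousAt.continuousWithinAt) ?_ ?_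
  · intro z hz
    rw [interior_Ioi] at hz
    exact (hasDerivAt_scaledCoth hl hz).hasDerivWithinAt
  · intro z hz
    rw [interior_Ioi] at hz
    exact neg_nonpos.2 (kernel_pos hl hz).le

/-- The kernel is log-convex: it lies above the exponential with the same value and
logarithmic slope at `z`. -/
lemma kernel_mul_exp_le {l z w : ℝ} (hl : 0 ≤ l) (hz : 0 < z) (hw : 0 < w) :
    kernel l z * exp (-2 * scaledCoth l z * (w - z)) ≤ kernel l w := by
  have hSz := scaledSinh_pos hl hz
  have hSw := scaledSinh_pos hl hw
  -- `log (scaledSinh l)` is concave, hence below its tangent at `z`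
  have key : log (scaledSinh l w) ≤ log (scaledSinh l z) + scaledCoth l z * (w - z) := by
    rcases lt_trichotomy z w with h | h | h
    · obtain ⟨ξ, hξ, e⟩ := exists_hasDerivAt_eq_slope (fun z => log (scaledSinh l z))
        (scaledCoth l) h
        (fun u hu => (hasDerivAt_log_scaledSinh hl
          (hz.trans_le hu.1)).continuousAt.continuousWithinAt)
        (fun u hu => hasDerivAt_log_scaledSinh hl (hz.trans hu.1))
      rw [eq_div_iff (by linarith)] at e
      have := scaledCoth_antitoneOn hl (Set.mem_Ioi.2 hz) (Set.mem_Ioi.2 (hz.trans hξ.1)) hξ.1.le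
      nlinarith
    · simp [h]
    · obtain ⟨ξ, hξ, e⟩ := exists_hasDerivAt_eq_slope (fun z => log (scaledSinh l z))
        (scaledCoth l) h
        (fun u hu => (hasDerivAt_log_scaledSinh hl
          (hw.trans_le hu.1)).continuousAt.continuousWithinAt)
        (fun u hu => hasDerivAt_log_scaledSinh hl (hw.trans hu.1))
      rw [eq_div_iff (by linarith)] at e
      have := scaledCoth_antitoneOn hl (Set.mem_Ioi.2 (hw.trans hξ.1)) (Set.mem_Ioi.2 hz) hξ.2.le
      nlinarith
  have e : ∀ u, 0 < u → kernel l u = exp (-2 * log (scaledSinh l u)) := by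
    intro u hu
    have hS := scaledSinh_pos hl hu
    rw [kernel, neg_mul, exp_neg, one_div, mul_comm, exp_mul, exp_log hS]
    norm_num
  rw [e z hz, e w hw, ← exp_add, exp_le_exp]
  linarith

lemma abs_kernelDeriv_le {l z : ℝ} (hl : 0 ≤ l) (hz : 0 < z) :
    |kernelDeriv l z| ≤ 2 * (l + 1 / z) * (1 / z ^ 2) := by
  have h1 := scaledCoth_le hl hz
  have h2 := kernel_le hl hz
  have h3 := (kernel_pos hl hz).le
  have h4 := (scaledCoth_pos hl hz).le
  rw [kernelDeriv, show -2 * scaledCoth l z * kernel l z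
    = -(2 * scaledCoth l z * kernel l z) by ring, abs_neg, abs_of_nonneg (by positivity)]
  gcongr

/-- `z² f(z)` decreases, for the kernel `f`, at a rate controlled by `l`; it is constant for
`l = 0`. -/
lemma two_mul_kernel_add_ge {l z : ℝ} (hl : 0 ≤ l) (hz : 0 < z) :
    -(2 * l ^ 2 / (3 + l ^ 2 * z ^ 2)) ≤ 2 * kernel l z + z * kernelDeriv l z := by
  have hS := scaledSinh_pos hl hz
  have h1 : ∀ w : ℝ, HasDerivAt (fun z : ℝ => l * z) l w := fun w => by
    simpa using (hasDerivAt_id' w).const_mul l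
  -- `z cosh (l z) - S ≤ (l z)² S / 3`
  have a1 : z * cosh (l * z) - scaledSinh l z ≤ l ^ 2 * z ^ 2 * scaledSinh l z / 3 := by
    have hd : ∀ w : ℝ, HasDerivAt
        (fun w => l ^ 2 * w ^ 2 * scaledSinh l w / 3 - (w * cosh (l * w) - scaledSinh l w))
        (l ^ 2 * w * (w * cosh (l * w) - scaledSinh l w) / 3) w := by
      intro w
      have := (((((hasDerivAt_id' w).pow 2).const_mul (l ^ 2)).mul
        (hasDerivAt_scaledSinh l w)).div_const 3).sub
        (((hasDerivAt_id' w).mul (h1 w).cosh).sub (hasDerivAt_scaledSinh l w))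
      refine this.congr_deriv ?_
      simp
      rw [← mul_scaledSinh]
      ring
    have hm : MonotoneOn (fun w => l ^ 2 * w ^ 2 * scaledSinh l w / 3 -
        (w * cosh (l * w) - scaledSinh l w)) (Set.Ici 0) := by
      refine monotoneOn_of_hasDerivWithinAt_nonneg (convex_Ici 0)
        (fun w _ => (hd w).continuousAt.continuousWithinAt)
        (fun w _ => (hd w).hasDerivWithinAt) ?_
      intro w hw
      rw [interior_Ici] at hw
      have hw' : (0 : ℝ) < w := hw
      have h := inv_le_scaledCoth hl hw'
      rw [scaledCoth, div_le_div_iff₀ hw' (scaledSinh_pos hl hw')] at h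
      have : 0 ≤ w * cosh (l * w) - scaledSinh l w := by linarith
      positivity
    have := hm (Set.mem_Ici.2 le_rfl) (Set.mem_Ici.2 hz.le) hz.le
    simp only [scaledSinh_zero, zero_mul, mul_zero, zero_div, sub_zero] at this
    linarith
  -- `S² ≥ z² (1 + (l z)² / 3)`
  have a2 : z ^ 2 * (3 + l ^ 2 * z ^ 2) ≤ 3 * scaledSinh l z ^ 2 := by
    have hd : ∀ w : ℝ, HasDerivAt
        (fun w => scaledSinh l w - (w + l ^ 2 * w ^ 3 / 6))
        (cosh (l * w) - (1 + l ^ 2 * w ^ 2 / 2)) w := by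
      intro w
      have := (hasDerivAt_scaledSinh l w).sub ((hasDerivAt_id' w).add
        ((((hasDerivAt_id' w).pow 3).const_mul (l ^ 2)).div_const 6))
      refine this.congr_deriv ?_
      simp
      ring
    have hm : MonotoneOn (fun w => scaledSinh l w - (w + l ^ 2 * w ^ 3 / 6)) (Set.Ici 0) := by
      refine monotoneOn_of_hasDerivWithinAt_nonneg (convex_Ici 0)
        (fun w _ => (hd w).continuousAt.continuousWithinAt)
        (fun w _ => (hd w).hasDerivWithinAt) ?_
      intro w hw
      rw [interior_Ici] at hw
      have hw' : (0 : ℝ) < w := hw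
      have h2 : cosh (l * w) = 1 + 2 * sinh (l * w / 2) ^ 2 := by
        rw [show l * w = 2 * (l * w / 2) by ring, cosh_two_mul, cosh_sq]; ring_nf
      have h3 : 0 ≤ l * w / 2 := by positivity
      have h4 := pow_le_pow_left₀ h3 (self_le_sinh_iff.2 h3) 2
      rw [h2]
      nlinarith
    have := hm (Set.mem_Ici.2 le_rfl) (Set.mem_Ici.2 hz.le) hz.le
    simp only [scaledSinh_zero] at this
    have h3 : z + l ^ 2 * z ^ 3 / 6 ≤ scaledSinh l z := by
      norm_num at this; linarith
    have h4 : 0 ≤ z + l ^ 2 * z ^ 3 / 6 := by positivity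
    have h5 := pow_le_pow_left₀ h4 h3 2
    have h6 : 0 ≤ (l ^ 2 * z ^ 3) ^ 2 := by positivity
    nlinarith
  have e : 2 * kernel l z + z * kernelDeriv l z =
      -(2 * (z * cosh (l * z) - scaledSinh l z) / scaledSinh l z ^ 3) := by
    simp only [kernelDeriv, kernel, scaledCoth]
    field_simp
    ring
  rw [e, neg_le_neg_iff, div_le_div_iff₀ (by positivity) (by positivity)]
  have h7 : 0 ≤ 3 + l ^ 2 * z ^ 2 := by positivity
  calc 2 * (z * cosh (l * z) - scaledSinh l z) * (3 + l ^ 2 * z ^ 2)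
      ≤ 2 * (l ^ 2 * z ^ 2 * scaledSinh l z / 3) * (3 + l ^ 2 * z ^ 2) := by gcongr
    _ = 2 * l ^ 2 * scaledSinh l z / 3 * (z ^ 2 * (3 + l ^ 2 * z ^ 2)) := by ring
    _ ≤ 2 * l ^ 2 * scaledSinh l z / 3 * (3 * scaledSinh l z ^ 2) := by gcongr
    _ = _ := by ring

end QGamma

/-! ### The series for the logarithm of the gamma function and its derivatives -/

namespace QGamma

open Real Set

lemma summable_one_div_add_sq {ε : ℝ} (hε : 0 < ε) :
    Summable fun n : ℕ => 1 / ((n : ℝ) + ε) ^ 2 := by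
  refine ((Real.summable_one_div_nat_add_rpow ε 2).2 (by norm_num)).congr fun n => ?_
  rw [abs_of_pos (by positivity)]
  norm_num

lemma summable_kernel {l x : ℝ} (hl : 0 ≤ l) (hx : 0 < x) :
    Summable fun n : ℕ => kernel l (n + x) :=
  Summable.of_nonneg_of_le (fun n => (kernel_pos hl (by positivity)).le)
    (fun n => kernel_le hl (by positivity)) (summable_one_div_add_sq hx)

lemma abs_kernelDeriv_add_le {l ε x : ℝ} (hl : 0 ≤ l) (hε : 0 < ε) (hx : ε ≤ x) (n : ℕ) :
    |kernelDeriv l (n + x)| ≤ 2 * (l + 1 / ε) * (1 / ((n : ℝ) + ε) ^ 2) := by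
  have hx0 : 0 < x := hε.trans_le hx
  refine (abs_kernelDeriv_le hl (by positivity)).trans ?_
  gcongr
  linarith [(Nat.cast_nonneg n : (0 : ℝ) ≤ n)]

lemma summable_kernelDeriv {l x : ℝ} (hl : 0 ≤ l) (hx : 0 < x) :
    Summable fun n : ℕ => kernelDeriv l (n + x) :=
  Summable.of_norm_bounded ((summable_one_div_add_sq hx).mul_left (2 * (l + 1 / x)))
    fun n => abs_kernelDeriv_add_le hl hx le_rfl n

/-- The terms of the Euler-type series for the logarithm of the gamma function. The linear
part in `x` makes every term vanish at `x = 1` and at `x = 2`. -/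
noncomputable def logGammaTerm (l : ℝ) (n : ℕ) (x : ℝ) : ℝ :=
  log (scaledSinh l (n + 1)) - log (scaledSinh l (n + x)) +
    (x - 1) * (log (scaledSinh l (n + 2)) - log (scaledSinh l (n + 1)))

/-- The derivative of `logGammaTerm l n`. -/
noncomputable def digammaTerm (l : ℝ) (n : ℕ) (x : ℝ) : ℝ :=
  log (scaledSinh l (n + 2)) - log (scaledSinh l (n + 1)) - scaledCoth l (n + x)

/-- The logarithm of the gamma function, with the two parameters `l = |log q| / 2` and
`c = max (log q) 0` in place of `q`. -/
noncomputable def logGamma (c l x : ℝ) : ℝ :=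
  c / 2 * ((x - 1) * (x - 2)) + ∑' n : ℕ, logGammaTerm l n x

/-- The derivative of `logGamma c l`. -/
noncomputable def digamma (c l x : ℝ) : ℝ :=
  c * (x - 3 / 2) + ∑' n : ℕ, digammaTerm l n x

/-- The second derivative of `logGamma c l`. -/
noncomputable def trigamma (c l x : ℝ) : ℝ := c + ∑' n : ℕ, kernel l (n + x)

/-- The third derivative of `logGamma c l`. -/
noncomputable def trigammaDeriv (l x : ℝ) : ℝ := ∑' n : ℕ, kernelDeriv l (n + x)

lemma logGammaTerm_one (l : ℝ) (n : ℕ) : logGammaTerm l n 1 = 0 := by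
  simp [logGammaTerm]

lemma logGammaTerm_two (l : ℝ) (n : ℕ) : logGammaTerm l n 2 = 0 := by
  simp [logGammaTerm]; ring

lemma logGamma_one (c l : ℝ) : logGamma c l 1 = 0 := by
  simp [logGamma, logGammaTerm_one]

lemma logGamma_two (c l : ℝ) : logGamma c l 2 = 0 := by
  simp [logGamma, logGammaTerm_two]

lemma hasDerivAt_natCast_add (n : ℕ) (x : ℝ) : HasDerivAt (fun x : ℝ => (n : ℝ) + x) 1 x :=
  (hasDerivAt_id' x).const_add _

lemma hasDerivAt_logGammaTerm {l x : ℝ} (hl : 0 ≤ l) (hx : 0 < x) (n : ℕ) :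
    HasDerivAt (logGammaTerm l n) (digammaTerm l n x) x := by
  have hz : 0 < (n : ℝ) + x := by positivity
  have h1 := (hasDerivAt_log_scaledSinh hl hz).comp x (hasDerivAt_natCast_add n x)
  have h2 := (((hasDerivAt_id' x).sub_const 1).mul_const
    (log (scaledSinh l (n + 2)) - log (scaledSinh l (n + 1))))
  refine ((h1.const_sub (log (scaledSinh l (n + 1)))).add h2).congr_deriv ?_
  rw [digammaTerm]
  ring

lemma hasDerivAt_digammaTerm {l x : ℝ} (hl : 0 ≤ l) (hx : 0 < x) (n : ℕ) :
    HasDerivAt (digammaTerm l n) (kernel l (n + x)) x := by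
  have hz : 0 < (n : ℝ) + x := by positivity
  have h1 := (hasDerivAt_scaledCoth hl hz).comp x (hasDerivAt_natCast_add n x)
  refine (h1.const_sub (log (scaledSinh l (n + 2)) - log (scaledSinh l (n + 1)))).congr_deriv ?_
  ring

/-- Since `logGammaTerm l n` takes equal values at `1` and `2`, its derivative vanishes in
between, and is therefore controlled by the second derivative. -/
lemma abs_digammaTerm_le {l ε K x : ℝ} (hl : 0 ≤ l) (hε : 0 < ε) (hε1 : ε ≤ 1) (hK : 2 ≤ K)
    (hx : x ∈ Ioo ε K) (n : ℕ) :
    |digammaTerm l n x| ≤ K * (1 / ((n : ℝ) + ε) ^ 2) := by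
  obtain ⟨ξ, hξ, e⟩ := exists_hasDerivAt_eq_zero (f := logGammaTerm l n)
    (f' := digammaTerm l n) (one_lt_two : (1 : ℝ) < 2)
    (fun u hu => (hasDerivAt_logGammaTerm hl
      (zero_lt_one.trans_le hu.1) n).continuousAt.continuousWithinAt)
    (by rw [logGammaTerm_one, logGammaTerm_two])
    (fun u hu => hasDerivAt_logGammaTerm hl (zero_lt_one.trans hu.1) n)
  have hb : ∀ u ∈ Ioo ε K, ‖kernel l (n + u)‖ ≤ 1 / ((n : ℝ) + ε) ^ 2 := by
    intro u hu
    have hu0 : 0 < u := hε.trans hu.1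
    rw [norm_of_nonneg (kernel_pos hl (by positivity)).le]
    refine (kernel_le hl (by positivity)).trans ?_
    have := hu.1.le
    gcongr
  have h := (convex_Ioo ε K).norm_image_sub_le_of_norm_hasDerivWithin_le
    (fun u hu => (hasDerivAt_digammaTerm hl (hε.trans hu.1) n).hasDerivWithinAt) hb
    (⟨hε1.trans_lt hξ.1, hξ.2.trans_le hK⟩ : ξ ∈ Ioo ε K) hx
  rw [e, sub_zero, norm_eq_abs, norm_eq_abs, mul_comm] at h
  refine h.trans ?_
  have : |x - ξ| ≤ K := by
    rw [abs_le]
    constructor <;> linarith [hx.1, hx.2, hξ.1, hξ.2]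
  gcongr

lemma exists_mem_Ioo {x : ℝ} (hx : 0 < x) :
    ∃ ε K : ℝ, 0 < ε ∧ ε < 1 ∧ 2 ≤ K ∧ x ∈ Ioo ε K :=
  ⟨min x 1 / 2, x + 2, by positivity, by linarith [min_le_right x 1], by linarith,
    by linarith [min_le_left x 1, lt_min hx one_pos], by linarith⟩

lemma summable_digammaTerm {l x : ℝ} (hl : 0 ≤ l) (hx : 0 < x) :
    Summable fun n : ℕ => digammaTerm l n x := by
  obtain ⟨ε, K, hε, hε1, hK, hm⟩ := exists_mem_Ioo hx
  exact Summable.of_norm_bounded ((summable_one_div_add_sq hε).mul_left K)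
    fun n => abs_digammaTerm_le hl hε hε1.le hK hm n

lemma summable_logGammaTerm {l x : ℝ} (hl : 0 ≤ l) (hx : 0 < x) :
    Summable fun n : ℕ => logGammaTerm l n x := by
  obtain ⟨ε, K, hε, hε1, hK, hm⟩ := exists_mem_Ioo hx
  exact summable_of_summable_hasDerivAt_of_isPreconnected
    ((summable_one_div_add_sq hε).mul_left K) isOpen_Ioo isPreconnected_Ioo
    (fun n y hy => hasDerivAt_logGammaTerm hl (hε.trans hy.1) n)
    (fun n y hy => abs_digammaTerm_le hl hε hε1.le hK hy n)
    (y₀ := 1) ⟨hε1, by linarith⟩ (by simp [logGammaTerm_one]) hm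

lemma hasDerivAt_logGamma (c : ℝ) {l x : ℝ} (hl : 0 ≤ l) (hx : 0 < x) :
    HasDerivAt (logGamma c l) (digamma c l x) x := by
  obtain ⟨ε, K, hε, hε1, hK, hm⟩ := exists_mem_Ioo hx
  have h := hasDerivAt_tsum_of_isPreconnected
    ((summable_one_div_add_sq hε).mul_left K) isOpen_Ioo isPreconnected_Ioo
    (fun n y hy => hasDerivAt_logGammaTerm hl (hε.trans hy.1) n)
    (fun n y hy => abs_digammaTerm_le hl hε hε1.le hK hy n)
    (y₀ := 1) ⟨hε1, by linarith⟩ (by simp [logGammaTerm_one]) hm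
  have h2 := (((hasDerivAt_id' x).sub_const 1).mul ((hasDerivAt_id' x).sub_const 2)).const_mul
    (c / 2)
  refine (h2.add h).congr_deriv ?_
  rw [digamma]
  ring

lemma hasDerivAt_digamma (c : ℝ) {l x : ℝ} (hl : 0 ≤ l) (hx : 0 < x) :
    HasDerivAt (digamma c l) (trigamma c l x) x := by
  obtain ⟨ε, K, hε, hε1, hK, hm⟩ := exists_mem_Ioo hx
  have h := hasDerivAt_tsum_of_isPreconnected
    (summable_one_div_add_sq hε) isOpen_Ioo isPreconnected_Ioo
    (fun n y hy => hasDerivAt_digammaTerm hl (hε.trans hy.1) n)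
    (fun n y hy => by
      have hy0 : 0 < y := hε.trans hy.1
      have := hy.1.le
      rw [norm_of_nonneg (kernel_pos hl (by positivity)).le]
      refine (kernel_le hl (by positivity)).trans ?_
      gcongr)
    hm (summable_digammaTerm hl hx) hm
  have h2 := ((hasDerivAt_id' x).sub_const (3 / 2)).const_mul c
  refine (h2.add h).congr_deriv ?_
  rw [trigamma]
  ring

lemma hasDerivAt_trigamma (c : ℝ) {l x : ℝ} (hl : 0 ≤ l) (hx : 0 < x) :
    HasDerivAt (trigamma c l) (trigammaDeriv l x) x := by
  obtain ⟨ε, K, hε, hε1, hK, hm⟩ := exists_mem_Ioo hx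
  have h := hasDerivAt_tsum_of_isPreconnected
    ((summable_one_div_add_sq hε).mul_left (2 * (l + 1 / ε))) isOpen_Ioo isPreconnected_Ioo
    (g := fun (n : ℕ) y => kernel l (n + y)) (g' := fun n y => kernelDeriv l (n + y))
    (fun n y hy => by
      have hy0 : 0 < y := hε.trans hy.1
      exact ((hasDerivAt_kernel hl (by positivity : 0 < (n : ℝ) + y)).comp y
        (hasDerivAt_natCast_add n y)).congr_deriv (mul_one _))
    (fun n y hy => abs_kernelDeriv_add_le hl hε hy.1.le n)
    hm (summable_kernel hl hx) hm
  exact h.const_add c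

/-! ### Estimates for the trigamma function -/

lemma trigamma_pos {c l x : ℝ} (hc : 0 ≤ c) (hl : 0 ≤ l) (hx : 0 < x) : 0 < trigamma c l x :=
  add_pos_of_nonneg_of_pos hc ((summable_kernel hl hx).tsum_pos
    (fun n => (kernel_pos hl (by positivity)).le) 0 (kernel_pos hl (by positivity)))

lemma kernelDeriv_neg {l z : ℝ} (hl : 0 ≤ l) (hz : 0 < z) : kernelDeriv l z < 0 := by
  have h1 := kernel_pos hl hz
  have h2 := scaledCoth_pos hl hz
  rw [kernelDeriv, neg_mul, neg_mul]
  exact neg_neg_of_pos (by positivity)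

lemma trigammaDeriv_neg {l x : ℝ} (hl : 0 ≤ l) (hx : 0 < x) : trigammaDeriv l x < 0 := by
  have h := (summable_kernelDeriv hl hx).neg.tsum_pos
    (fun n => (neg_pos.2 (kernelDeriv_neg hl (by positivity))).le) 0
    (neg_pos.2 (kernelDeriv_neg hl (by positivity)))
  rw [tsum_neg] at h
  exact neg_pos.1 h

/-- The logarithmic slope of the trigamma function lies above any lower bound for that of the
kernel terms. -/
lemma trigammaDeriv_ge {c l x B : ℝ} (hc : 0 ≤ c) (hl : 0 ≤ l) (hx : 0 < x) (hB : 0 ≤ B)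
    (h : ∀ z, x ≤ z → 2 * scaledCoth l z ≤ B) :
    -B * trigamma c l x ≤ trigammaDeriv l x := by
  have h1 : ∑' n : ℕ, -B * kernel l (n + x) ≤ trigammaDeriv l x := by
    refine Summable.tsum_le_tsum (fun n => ?_) ((summable_kernel hl hx).mul_left _)
      (summable_kernelDeriv hl hx)
    have h2 := kernel_pos hl (by positivity : 0 < (n : ℝ) + x)
    have h3 := h (n + x) (by simp)
    rw [kernelDeriv]
    nlinarith
  rw [tsum_mul_left] at h1
  rw [trigamma]
  nlinarith

lemma trigammaDeriv_ge_at_one {c l x : ℝ} (hc : 0 ≤ c) (hl : 0 ≤ l) (hx : 1 ≤ x) :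
    -(2 * scaledCoth l 1) * trigamma c l x ≤ trigammaDeriv l x := by
  have h0 := scaledCoth_pos hl one_pos
  refine trigammaDeriv_ge hc hl (by linarith) (by positivity) fun z hz => ?_
  have := scaledCoth_antitoneOn hl (mem_Ioi.2 one_pos)
    (mem_Ioi.2 (by linarith : 0 < z)) (hx.trans hz)
  linarith

lemma trigammaDeriv_ge_add {c l x : ℝ} (hc : 0 ≤ c) (hl : 0 ≤ l) (hx : 0 < x) :
    -(2 * l + 2 / x) * trigamma c l x ≤ trigammaDeriv l x := by
  refine trigammaDeriv_ge hc hl hx (by positivity) fun z hz => ?_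
  have h1 := scaledCoth_le hl (hx.trans_le hz)
  have h2 : 1 / z ≤ 1 / x := one_div_le_one_div_of_le hx hz
  have : 2 / x = 2 * (1 / x) := by ring
  linarith

lemma trigammaDeriv_le {l x : ℝ} (hl : 0 ≤ l) (hx : 0 < x) :
    trigammaDeriv l x ≤ -(2 * l) * trigamma 0 l x := by
  rw [trigamma, zero_add, ← tsum_mul_left]
  refine Summable.tsum_le_tsum (fun n => ?_) (summable_kernelDeriv hl hx)
    ((summable_kernel hl hx).mul_left _)
  have hz : 0 < (n : ℝ) + x := by positivity
  have h2 := kernel_pos hl hz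
  have h3 := le_scaledCoth hl hz
  rw [kernelDeriv]
  nlinarith

/-- Log-convexity of the trigamma function, as an exponential lower bound. -/
lemma trigamma_mul_exp_le {c l x w : ℝ} (hc : 0 ≤ c) (hl : 0 ≤ l) (hx : 0 < x) (hw : 0 < w) :
    trigamma c l x * exp (trigammaDeriv l x / trigamma c l x * (w - x)) ≤ trigamma c l w := by
  set s := trigammaDeriv l x / trigamma c l x with hs
  have hD := trigamma_pos hc hl hx
  have hsD : s * trigamma c l x = trigammaDeriv l x := div_mul_cancel₀ _ hD.ne'
  -- after multiplication by `exp (-s (w - x))` each term lies above its tangent line at `x`,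
  -- and the slopes of these tangents add up to zero
  have hterm : ∀ n : ℕ, kernel l (n + x) * (1 - s * (w - x)) +
      kernelDeriv l (n + x) * (w - x) ≤ kernel l (n + w) * exp (-(s * (w - x))) := by
    intro n
    have hz : 0 < (n : ℝ) + x := by positivity
    have hz' : 0 < (n : ℝ) + w := by positivity
    have h1 := kernel_mul_exp_le hl hz hz'
    have h2 := kernel_pos hl hz
    set k := scaledCoth l (n + x)
    have h3 := add_one_le_exp (-2 * k * (w - x) - s * (w - x))
    calc _ = kernel l (n + x) * (-2 * k * (w - x) - s * (w - x) + 1) := by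
            rw [kernelDeriv]; ring
      _ ≤ kernel l (n + x) * exp (-2 * k * (w - x) - s * (w - x)) := by gcongr
      _ = kernel l (n + x) * exp (-2 * k * (n + w - (n + x))) * exp (-(s * (w - x))) := by
            rw [mul_assoc (kernel l (n + x)), ← exp_add]; congr 2; ring
      _ ≤ _ := by gcongr
  have hsum : (∑' n : ℕ, kernel l (n + x)) * (1 - s * (w - x)) +
      trigammaDeriv l x * (w - x) ≤ (∑' n : ℕ, kernel l (n + w)) * exp (-(s * (w - x))) := by
    rw [trigammaDeriv, ← tsum_mul_right, ← tsum_mul_right, ← tsum_mul_right,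
      ← Summable.tsum_add ((summable_kernel hl hx).mul_right _)
        ((summable_kernelDeriv hl hx).mul_right _)]
    exact Summable.tsum_le_tsum hterm
      (((summable_kernel hl hx).mul_right _).add ((summable_kernelDeriv hl hx).mul_right _))
      ((summable_kernel hl hw).mul_right _)
  have hconst : c * (1 - s * (w - x)) ≤ c * exp (-(s * (w - x))) := by
    have := add_one_le_exp (-(s * (w - x)))
    gcongr
    linarith
  have h : trigamma c l x ≤ trigamma c l w * exp (-(s * (w - x))) := by
    have : trigamma c l x = trigamma c l x * (1 - s * (w - x)) + trigammaDeriv l x * (w - x) := by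
      rw [← hsD]; ring
    rw [this]
    unfold trigamma at *
    linarith
  calc _ ≤ trigamma c l w * exp (-(s * (w - x))) * exp (s * (w - x)) := by gcongr
    _ = _ := by rw [mul_assoc, ← exp_add]; simp

lemma trigamma_tangent_le {c l x w : ℝ} (hc : 0 ≤ c) (hl : 0 ≤ l) (hx : 0 < x) (hw : 0 < w) :
    trigamma c l x + trigammaDeriv l x * (w - x) ≤ trigamma c l w := by
  have h := trigamma_mul_exp_le hc hl hx hw
  have hD := trigamma_pos hc hl hx
  have h2 := add_one_le_exp (trigammaDeriv l x / trigamma c l x * (w - x))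
  have h3 := mul_le_mul_of_nonneg_left h2 hD.le
  have e : trigamma c l x * (trigammaDeriv l x / trigamma c l x * (w - x) + 1) =
      trigamma c l x + trigammaDeriv l x * (w - x) := by field_simp; ring
  linarith

/-- The key estimate for `q ≥ 1`: the function `x² ψ'(x)` is nondecreasing. The constant term
`c = 2 l` outweighs the negative contributions of the kernel, which are summed by a
telescoping bound. -/
lemma two_mul_trigamma_add_nonneg {l x : ℝ} (hl : 0 ≤ l) (hx : 1 / 2 ≤ x) :
    0 ≤ 2 * trigamma (2 * l) l x + x * trigammaDeriv l x := by
  have hx0 : 0 < x := by linarith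
  have hu : ∀ n : ℕ, 0 ≤ 2 * l ^ 2 / (3 + l ^ 2 * ((n : ℝ) + x) ^ 2) := fun n => by positivity
  have hpart : ∀ N : ℕ, ∑ n ∈ Finset.range N, 2 * l ^ 2 / (3 + l ^ 2 * ((n : ℝ) + x) ^ 2) ≤
      7 / 2 * l * (1 / (l * (x - 1 / 2) + 3 / 2) - 1 / (l * (N + x - 1 / 2) + 3 / 2)) := by
    intro N
    induction N with
    | zero => simp
    | succ N ih =>
      rw [Finset.sum_range_succ]
      have h1 : 0 < l * (N + x - 1 / 2) + 3 / 2 := by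
        have : 0 ≤ (N : ℝ) + x - 1 / 2 := by linarith [(Nat.cast_nonneg N : (0 : ℝ) ≤ N)]
        positivity
      have h2 : 0 < l * (((N + 1 : ℕ) : ℝ) + x - 1 / 2) + 3 / 2 := by
        have : 0 ≤ ((N + 1 : ℕ) : ℝ) + x - 1 / 2 := by
          linarith [(Nat.cast_nonneg (N + 1) : (0 : ℝ) ≤ ((N + 1 : ℕ) : ℝ))]
        positivity
      have h3 : 2 * l ^ 2 / (3 + l ^ 2 * ((N : ℝ) + x) ^ 2) ≤
          7 / 2 * l * (1 / (l * (N + x - 1 / 2) + 3 / 2) -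
            1 / (l * (((N + 1 : ℕ) : ℝ) + x - 1 / 2) + 3 / 2)) := by
        push_cast at h2 ⊢
        rw [div_sub_div _ _ h1.ne' h2.ne', mul_div_assoc', div_le_div_iff₀ (by positivity)
          (by positivity)]
        have : 0 ≤ l ^ 2 * (l * (N + x) - 2) ^ 2 := by positivity
        have h5 : 0 ≤ l ^ 2 * l ^ 2 := by positivity
        nlinarith
      linarith
  have hbound : ∀ N : ℕ, ∑ n ∈ Finset.range N, 2 * l ^ 2 / (3 + l ^ 2 * ((n : ℝ) + x) ^ 2) ≤
      4 * l := by
    refine fun N => (hpart N).trans ?_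
    have h1 : 1 / (l * (x - 1 / 2) + 3 / 2) ≤ 1 := by
      rw [div_le_one (by nlinarith)]; nlinarith
    have h2 : 0 ≤ 1 / (l * (N + x - 1 / 2) + 3 / 2) := by
      have : 0 ≤ (N : ℝ) + x - 1 / 2 := by linarith [(Nat.cast_nonneg N : (0 : ℝ) ≤ N)]
      positivity
    nlinarith
  have hle := Real.tsum_le_of_sum_range_le hu hbound
  have hsu := summable_of_sum_range_le hu hbound
  have hsum : -∑' n : ℕ, 2 * l ^ 2 / (3 + l ^ 2 * ((n : ℝ) + x) ^ 2) ≤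
      2 * (∑' n : ℕ, kernel l (n + x)) + x * trigammaDeriv l x := by
    rw [trigammaDeriv, ← tsum_neg, ← tsum_mul_left, ← tsum_mul_left,
      ← Summable.tsum_add ((summable_kernel hl hx0).mul_left _)
        ((summable_kernelDeriv hl hx0).mul_left _)]
    refine Summable.tsum_le_tsum (fun n => ?_) hsu.neg
      (((summable_kernel hl hx0).mul_left _).add ((summable_kernelDeriv hl hx0).mul_left _))
    have hz : 0 < (n : ℝ) + x := by positivity
    have h1 := two_mul_kernel_add_ge hl hz
    have h2 := kernelDeriv_neg hl hz
    have h3 : (0 : ℝ) ≤ n := Nat.cast_nonneg n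
    nlinarith
  rw [trigamma]
  linarith

lemma trigamma_two (c : ℝ) {l : ℝ} (hl : 0 ≤ l) :
    trigamma c l 2 = trigamma c l 1 - kernel l 1 := by
  have h := (summable_kernel hl one_pos).tsum_eq_zero_add
  rw [trigamma, trigamma, h]
  have : ∀ n : ℕ, kernel l (((n + 1 : ℕ) : ℝ) + 1) = kernel l (n + 2) := by
    intro n; congr 1; push_cast; ring
  simp only [this]
  simp
  ring

lemma scaledSinh_one_mul_le {l z : ℝ} (hl : 0 ≤ l) (hz : 1 ≤ z) :
    z * scaledSinh l 1 ≤ scaledSinh l z := by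
  have hanti : MonotoneOn (fun w => scaledSinh l w / w) (Ici 1) := by
    refine monotoneOn_of_hasDerivWithinAt_nonneg (convex_Ici 1)
      (f' := fun w => (cosh (l * w) * w - scaledSinh l w * 1) / w ^ 2) ?_ ?_ ?_
    · intro w hw
      have hw0 : (0 : ℝ) < w := zero_lt_one.trans_le hw
      exact ((hasDerivAt_scaledSinh l w).div (hasDerivAt_id' w)
        hw0.ne').continuousAt.continuousWithinAt
    · intro w hw
      rw [interior_Ici] at hw
      have hw0 : (0 : ℝ) < w := zero_lt_one.trans hw
      exact ((hasDerivAt_scaledSinh l w).div (hasDerivAt_id' w) hw0.ne').hasDerivWithinAt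
    · intro w hw
      rw [interior_Ici] at hw
      have hw0 : (0 : ℝ) < w := zero_lt_one.trans hw
      have h := inv_le_scaledCoth hl hw0
      rw [scaledCoth, div_le_div_iff₀ hw0 (scaledSinh_pos hl hw0)] at h
      have : 0 ≤ cosh (l * w) * w - scaledSinh l w * 1 := by linarith
      positivity
  have h := hanti (mem_Ici.2 le_rfl) (mem_Ici.2 hz) hz
  simp only [div_one] at h
  rw [le_div_iff₀ (by linarith)] at h
  linarith

lemma trigamma_two_le {l : ℝ} (hl : 0 ≤ l) : trigamma 0 l 2 ≤ trigamma 0 l 1 / 2 := by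
  have hk := kernel_pos hl one_pos
  have hS := scaledSinh_pos hl one_pos
  have hpart : ∀ N : ℕ, ∑ n ∈ Finset.range N, kernel l ((n : ℝ) + 2) ≤
      kernel l 1 * (1 - 1 / ((N : ℝ) + 1)) := by
    intro N
    induction N with
    | zero => simp
    | succ N ih =>
      rw [Finset.sum_range_succ]
      have h1 : kernel l ((N : ℝ) + 2) ≤ kernel l 1 * (1 / ((N : ℝ) + 2) ^ 2) := by
        have h2 := scaledSinh_one_mul_le hl (by linarith [(Nat.cast_nonneg N : (0 : ℝ) ≤ N)] :
          1 ≤ (N : ℝ) + 2)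
        have h3 := pow_le_pow_left₀ (by positivity) h2 2
        rw [kernel, kernel, one_div_mul_one_div, ← mul_pow, mul_comm (scaledSinh l 1)]
        exact one_div_le_one_div_of_le (by positivity) h3
      have h4 : 1 / ((N : ℝ) + 2) ^ 2 ≤ 1 / ((N : ℝ) + 1) - 1 / (((N + 1 : ℕ) : ℝ) + 1) := by
        push_cast
        rw [div_sub_div _ _ (by positivity) (by positivity),
          div_le_div_iff₀ (by positivity) (by positivity)]
        nlinarith [(Nat.cast_nonneg N : (0 : ℝ) ≤ N)]
      nlinarith
  have h : trigamma 0 l 2 ≤ kernel l 1 := by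
    rw [trigamma, zero_add]
    refine Real.tsum_le_of_sum_range_le (fun n => (kernel_pos hl (by positivity)).le)
      fun N => (hpart N).trans ?_
    have : 0 ≤ 1 / ((N : ℝ) + 1) := by positivity
    nlinarith
  linarith [trigamma_two 0 hl]

end QGamma

/-! ### The series represents the `q`-gamma function -/

namespace QGamma

open Real Set Filter Topology

lemma one_sub_exp_pos {l z : ℝ} (hl : 0 < l) (hz : 0 < z) : 0 < 1 - exp (-(2 * l) * z) := by
  have : exp (-(2 * l) * z) < 1 := exp_lt_one_iff.2 (by nlinarith [mul_pos hl hz])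
  linarith

lemma log_scaledSinh {l z : ℝ} (hl : 0 < l) (hz : 0 < z) :
    log (scaledSinh l z) = l * z + log (1 - exp (-(2 * l) * z)) - log (2 * l) := by
  have h1 := one_sub_exp_pos hl hz
  have e : scaledSinh l z = exp (l * z) * (1 - exp (-(2 * l) * z)) / (2 * l) := by
    rw [scaledSinh, if_neg hl.ne', sinh_eq, mul_sub, ← exp_add]
    ring_nf
  rw [e, log_div (by positivity) (by positivity), log_mul (by positivity) h1.ne', log_exp]

lemma tprod_one_sub_exp {l x : ℝ} (hl : 0 < l) (hx : 0 < x) :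
    ∏' n : ℕ, (1 - exp (-(2 * l) * (n + 1))) / (1 - exp (-(2 * l) * (n + x))) =
      exp (∑' n : ℕ, logGammaTerm l n x + (x - 1) * log (1 - exp (-(2 * l)))) := by
  set w : ℕ → ℝ := fun n => log (1 - exp (-(2 * l) * (n + 1))) with hw
  have hw0 : w 0 = log (1 - exp (-(2 * l))) := by simp [hw]
  have hpos : ∀ (n : ℕ) {y : ℝ}, 0 < y → 0 < 1 - exp (-(2 * l) * (n + y)) :=
    fun n y hy => one_sub_exp_pos hl (by positivity)
  have htel : HasSum (fun n => w (n + 1) - w n) (0 - w 0) := by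
    rw [hasSum_iff_tendsto_nat_of_nonneg]
    · simp only [Finset.sum_range_sub]
      refine Tendsto.sub_const ?_ _
      rw [← log_one]
      refine Tendsto.log ?_ one_ne_zero
      have h1 : Tendsto (fun n : ℕ => exp (-(2 * l) * ((n : ℝ) + 1))) atTop (𝓝 0) := by
        refine tendsto_exp_atBot.comp (Tendsto.const_mul_atTop_of_neg (by linarith) ?_)
        exact tendsto_atTop_add_const_right _ _ tendsto_natCast_atTop_atTop
      simpa using h1.const_sub 1
    · intro n
      refine sub_nonneg.2 (log_le_log (hpos n one_pos) ?_)
      gcongr _ - exp ?_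
      push_cast
      nlinarith
  have hterm : ∀ n : ℕ,
      log ((1 - exp (-(2 * l) * (n + 1))) / (1 - exp (-(2 * l) * (n + x)))) =
        logGammaTerm l n x - (x - 1) * (w (n + 1) - w n) := by
    intro n
    rw [log_div (hpos n one_pos).ne' (hpos n hx).ne', logGammaTerm,
      log_scaledSinh hl (by positivity), log_scaledSinh hl (by positivity),
      log_scaledSinh hl (by positivity)]
    simp only [hw]
    push_cast
    rw [show (n : ℝ) + 1 + 1 = n + 2 by ring]
    ring
  have hsum := (summable_logGammaTerm hl.le hx).hasSum.sub (htel.mul_left (x - 1))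
  simp only [← hterm] at hsum
  rw [← Real.rexp_tsum_eq_tprod (fun n => div_pos (hpos n one_pos) (hpos n hx)) hsum.summable,
    hsum.tsum_eq, hw0]
  ring_nf

lemma log_Gamma_eq {x : ℝ} (hx : 0 < x) : log (Gamma x) = logGamma 0 0 x := by
  have hS : ∀ z : ℝ, scaledSinh 0 z = z := fun z => by simp [scaledSinh]
  have h1 := (summable_logGammaTerm le_rfl hx).hasSum.tendsto_sum_nat
  have h2 := BohrMollerup.tendsto_log_gamma hx
  -- the partial sums differ from Euler's sequence by a null sequence
  have hpart : ∀ N : ℕ, ∑ n ∈ Finset.range N, logGammaTerm 0 n x =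
      log (N.factorial : ℝ) - ∑ n ∈ Finset.range N, log (x + n) + (x - 1) * log (N + 1) := by
    intro N
    induction N with
    | zero => simp
    | succ N ih =>
      rw [Finset.sum_range_succ, Finset.sum_range_succ, ih, logGammaTerm, hS, hS, hS,
        Nat.factorial_succ]
      push_cast
      rw [log_mul (by positivity) (by positivity), add_comm (N : ℝ) x,
        show (N : ℝ) + 1 + 1 = N + 2 by ring]
      ring
  have hdiff : Tendsto (fun N : ℕ => ∑ n ∈ Finset.range N, logGammaTerm 0 n x -
      BohrMollerup.logGammaSeq x N) atTop (𝓝 0) := by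
    have h3 : Tendsto (fun N : ℕ => (x - 1) * log (1 + 1 / (N : ℝ)) + log (1 + x / (N : ℝ)))
        atTop (𝓝 ((x - 1) * log (1 + 0) + log (1 + 0))) := by
      refine (Tendsto.const_mul _ (Tendsto.log ?_ (by norm_num))).add
        (Tendsto.log ?_ (by norm_num))
      · exact (tendsto_const_div_atTop_nhds_zero_nat 1).const_add 1
      · exact (tendsto_const_div_atTop_nhds_zero_nat x).const_add 1
    simp only [add_zero, log_one, mul_zero] at h3
    refine h3.congr' ?_
    filter_upwards [eventually_gt_atTop 0] with N hN
    have hN' : (0 : ℝ) < N := Nat.cast_pos.2 hN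
    rw [hpart, BohrMollerup.logGammaSeq, Finset.sum_range_succ,
      show 1 + 1 / (N : ℝ) = (N + 1) / N by field_simp,
      show 1 + x / (N : ℝ) = (x + N) / N by field_simp; ring,
      log_div (by positivity) hN'.ne', log_div (by positivity) hN'.ne']
    ring
  have h4 := hdiff.add h2
  simp only [sub_add_cancel, zero_add] at h4
  rw [logGamma, tendsto_nhds_unique h4 h1]
  simp

/-- The `q`-gamma function is the exponential of the series, for all `q > 0`. -/
theorem qGamma_eq_exp {q x : ℝ} (hq : 0 < q) (hx : 0 < x) :
    qGamma q x = exp (logGamma (max (log q) 0) (|log q| / 2) x) := by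
  rcases lt_trichotomy q 1 with h | h | h
  · have hlog : log q < 0 := log_neg hq h
    have hl : 0 < |log q| / 2 := by rw [abs_of_neg hlog]; linarith
    have e : ∀ z : ℝ, q ^ z = exp (-(2 * (|log q| / 2)) * z) := by
      intro z
      rw [rpow_def_of_pos hq, abs_of_neg hlog]; ring_nf
    have e1 : q = exp (-(2 * (|log q| / 2))) := by simpa using e 1
    rw [qGamma, if_pos h, max_eq_right hlog.le]
    simp only [e]
    rw [tprod_one_sub_exp hl hx, rpow_def_of_pos (by linarith), ← exp_add, ← e1, logGamma]
    ring_nf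
  · subst h
    rw [qGamma, if_neg (lt_irrefl _), if_pos rfl]
    simp only [log_one, max_self, abs_zero, zero_div]
    rw [← log_Gamma_eq hx, exp_log (Gamma_pos_of_pos hx)]
  · have hlog : 0 < log q := log_pos h
    have hl : 0 < |log q| / 2 := by positivity
    have e : ∀ z : ℝ, q ^ (-z) = exp (-(2 * (|log q| / 2)) * z) := by
      intro z
      rw [rpow_def_of_pos hq, abs_of_pos hlog]; ring_nf
    have e1 : q⁻¹ = exp (-(2 * (|log q| / 2))) := by
      rw [← rpow_neg_one]; simpa using e 1
    rw [qGamma, if_neg h.not_gt, if_neg h.ne', max_eq_left hlog.le]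
    simp only [e]
    have e2 : q - 1 = q * (1 - q⁻¹) := by field_simp
    have h3 : 0 < 1 - q⁻¹ := by linarith [inv_lt_one_of_one_lt₀ h]
    rw [tprod_one_sub_exp hl hx, rpow_def_of_pos (by linarith), rpow_def_of_pos hq, ← exp_add,
      ← exp_add, ← e1, logGamma, e2, log_mul hq.ne' h3.ne']
    ring_nf

end QGamma

/-! ### Convexity properties of the digamma function -/

namespace QGamma

open Real Set

section Calculus

variable {f f' : ℝ → ℝ} {a b : ℝ}

lemma le_of_hasDerivAt_nonneg (hab : a ≤ b) (hf : ∀ x ∈ Icc a b, HasDerivAt f (f' x) x)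
    (h : ∀ x ∈ Ioo a b, 0 ≤ f' x) : f a ≤ f b := by
  refine monotoneOn_of_hasDerivWithinAt_nonneg (f' := f') (convex_Icc a b)
    (fun x hx => (hf x hx).continuousAt.continuousWithinAt) ?_ ?_
    (left_mem_Icc.2 hab) (right_mem_Icc.2 hab) hab
  · intro x hx
    exact (hf x (interior_subset hx)).hasDerivWithinAt
  · intro x hx
    rw [interior_Icc] at hx
    exact h x hx

lemma le_of_hasDerivAt_nonpos (hab : a ≤ b) (hf : ∀ x ∈ Icc a b, HasDerivAt f (f' x) x)
    (h : ∀ x ∈ Ioo a b, f' x ≤ 0) : f b ≤ f a := by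
  have := le_of_hasDerivAt_nonneg (f := -f) (f' := fun x => -f' x) hab
    (fun x hx => (hf x hx).neg) (fun x hx => neg_nonneg.2 (h x hx))
  simpa using this

lemma lt_of_hasDerivAt_pos (hab : a < b) (hf : ∀ x ∈ Icc a b, HasDerivAt f (f' x) x)
    (h : ∀ x ∈ Ioo a b, 0 < f' x) : f a < f b := by
  refine strictMonoOn_of_hasDerivWithinAt_pos (f' := f') (convex_Icc a b)
    (fun x hx => (hf x hx).continuousAt.continuousWithinAt) ?_ ?_
    (left_mem_Icc.2 hab.le) (right_mem_Icc.2 hab.le) hab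
  · intro x hx
    exact (hf x (interior_subset hx)).hasDerivWithinAt
  · intro x hx
    rw [interior_Icc] at hx
    exact h x hx

end Calculus

section Digamma

variable {c l x y s : ℝ}

lemma digamma_strictMonoOn (hc : 0 ≤ c) (hl : 0 ≤ l) : StrictMonoOn (digamma c l) (Ioi 0) :=
  fun _ ha _ _ hab => lt_of_hasDerivAt_pos hab
    (fun _ hx => hasDerivAt_digamma c hl (lt_of_lt_of_le ha hx.1))
    (fun _ hx => trigamma_pos hc hl (lt_trans ha hx.1))

lemma trigamma_antitoneOn (hl : 0 ≤ l) : AntitoneOn (trigamma c l) (Ioi 0) :=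
  fun _ ha _ _ hab => le_of_hasDerivAt_nonpos hab
    (fun _ hx => hasDerivAt_trigamma c hl (lt_of_lt_of_le ha hx.1))
    (fun _ hx => (trigammaDeriv_neg hl (lt_trans ha hx.1)).le)

/-- Concavity of the digamma function. -/
lemma digamma_le_tangent (hl : 0 ≤ l) (hx : 0 < x) (hs : 0 < s) :
    digamma c l s ≤ digamma c l x + trigamma c l x * (s - x) := by
  have hd : ∀ u, 0 < u → HasDerivAt (fun u => digamma c l u - trigamma c l x * (u - x))
      (trigamma c l u - trigamma c l x) u := fun u hu => by
    refine ((hasDerivAt_digamma c hl hu).sub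
      (((hasDerivAt_id' u).sub_const x).const_mul (trigamma c l x))).congr_deriv ?_
    ring
  rcases le_total x s with h | h
  · have := le_of_hasDerivAt_nonpos h (fun u hu => hd u (hx.trans_le hu.1))
      (fun u hu => sub_nonpos.2 (trigamma_antitoneOn hl hx (hx.trans hu.1) hu.1.le))
    simp only [sub_self, mul_zero, sub_zero] at this
    linarith
  · have := le_of_hasDerivAt_nonneg h (fun u hu => hd u (hs.trans_le hu.1))
      (fun u hu => sub_nonneg.2 (trigamma_antitoneOn hl (hs.trans hu.1) hx hu.2.le))
    simp only [sub_self, mul_zero, sub_zero] at this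
    linarith

/-- The logarithm of the gamma function has the same value at `1` and `2`, so its derivative
vanishes in between. -/
lemma digamma_one_neg (hc : 0 ≤ c) (hl : 0 ≤ l) : digamma c l 1 < 0 := by
  obtain ⟨ξ, hξ, e⟩ := exists_hasDerivAt_eq_zero (f := logGamma c l) (f' := digamma c l)
    (one_lt_two : (1 : ℝ) < 2)
    (fun u hu => (hasDerivAt_logGamma c hl
      (zero_lt_one.trans_le hu.1)).continuousAt.continuousWithinAt)
    (by rw [logGamma_one, logGamma_two])
    (fun u hu => hasDerivAt_logGamma c hl (zero_lt_one.trans hu.1))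
  rw [← e]
  exact digamma_strictMonoOn hc hl (mem_Ioi.2 one_pos) (mem_Ioi.2 (zero_lt_one.trans hξ.1)) hξ.1

/-- The zero of the digamma function is at most `3 / 2`: the mean value of the concave function
`ψ` on `[1, 2]` is zero, and at most its value at the midpoint. -/
lemma digamma_three_halves_nonneg (hl : 0 ≤ l) : 0 ≤ digamma c l (3 / 2) := by
  set p := digamma c l (3 / 2)
  set t := trigamma c l (3 / 2)
  have h := le_of_hasDerivAt_nonpos
    (f := fun u => logGamma c l u - (p * u + t * (u - 3 / 2) ^ 2 / 2))
    (f' := fun u => digamma c l u - (p + t * (u - 3 / 2))) (one_le_two : (1 : ℝ) ≤ 2) ?_ ?_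
  · simp only [logGamma_one, logGamma_two] at h
    linarith
  · intro u hu
    refine ((hasDerivAt_logGamma c hl (zero_lt_one.trans_le hu.1)).sub
      (((hasDerivAt_id' u).const_mul p).add
        (((((hasDerivAt_id' u).sub_const (3 / 2)).pow 2).const_mul t).div_const 2))).congr_deriv ?_
    simp
    ring
  · intro u hu
    have := digamma_le_tangent (c := c) hl (by norm_num : (0 : ℝ) < 3 / 2)
      (zero_lt_one.trans hu.1)
    linarith

lemma lt_three_halves (hc : 0 ≤ c) (hl : 0 ≤ l) (hx : 0 < x) (hψ : digamma c l x < 0) :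
    x < 3 / 2 := by
  by_contra! h
  have := (digamma_strictMonoOn hc hl).monotoneOn
    (mem_Ioi.2 (by norm_num : (0 : ℝ) < 3 / 2)) (mem_Ioi.2 hx) h
  linarith [digamma_three_halves_nonneg (c := c) hl]

lemma neg_digamma_le (hl : 0 ≤ l) (hx : 0 < x) :
    -digamma c l x ≤ trigamma c l x * (3 / 2 - x) := by
  linarith [digamma_le_tangent (c := c) hl hx (by norm_num : (0 : ℝ) < 3 / 2),
    digamma_three_halves_nonneg (c := c) hl]

/-- As `log Γ` vanishes at `1` and `2`, an upper bound for its second derivative on `[1, 2]`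
gives an upper bound for `-ψ 1`. -/
lemma neg_digamma_one_le {B B' B'' : ℝ → ℝ} (hl : 0 ≤ l)
    (hB : ∀ u ∈ Icc (1 : ℝ) 2, HasDerivAt B (B' u) u)
    (hB' : ∀ u ∈ Icc (1 : ℝ) 2, HasDerivAt B' (B'' u) u) (h1 : B 1 = 0) (h1' : B' 1 = 0)
    (hle : ∀ u ∈ Icc (1 : ℝ) 2, trigamma c l u ≤ B'' u) : -digamma c l 1 ≤ B 2 := by
  have hψ : ∀ u ∈ Icc (1 : ℝ) 2, digamma c l u - digamma c l 1 - B' u ≤ 0 := by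
    intro u hu
    have := le_of_hasDerivAt_nonpos (f := fun u => digamma c l u - digamma c l 1 - B' u)
      (f' := fun u => trigamma c l u - B'' u) hu.1
      (fun v hv => ((hasDerivAt_digamma c hl (zero_lt_one.trans_le hv.1)).sub_const _).sub
        (hB' v ⟨hv.1, hv.2.trans hu.2⟩))
      (fun v hv => sub_nonpos.2 (hle v ⟨hv.1.le, hv.2.le.trans hu.2⟩))
    simpa [h1'] using this
  have h := le_of_hasDerivAt_nonpos
    (f := fun u => logGamma c l u - digamma c l 1 * (u - 1) - B u)
    (f' := fun u => digamma c l u - digamma c l 1 - B' u) (one_le_two : (1 : ℝ) ≤ 2)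
    (fun v hv => by
      refine (((hasDerivAt_logGamma c hl (zero_lt_one.trans_le hv.1)).sub
        (((hasDerivAt_id' v).sub_const 1).const_mul (digamma c l 1))).sub
          (hB v hv)).congr_deriv ?_
      ring)
    (fun v hv => hψ v (Ioo_subset_Icc_self hv))
  simp only [logGamma_one, logGamma_two, h1] at h
  linarith

/-- Convexity of the trigamma function bounds it on `[1, 2]` by its chord. -/
lemma neg_digamma_one_le_chord (hc : 0 ≤ c) (hl : 0 ≤ l) :
    -digamma c l 1 ≤ trigamma c l 1 / 3 + trigamma c l 2 / 6 := by
  set t₁ := trigamma c l 1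
  set t₂ := trigamma c l 2
  have h := neg_digamma_one_le (c := c) (l := l)
    (B := fun u => t₁ * (u - 1) ^ 2 / 2 + (t₂ - t₁) * (u - 1) ^ 3 / 6)
    (B' := fun u => t₁ * (u - 1) + (t₂ - t₁) * (u - 1) ^ 2 / 2)
    (B'' := fun u => t₁ + (t₂ - t₁) * (u - 1)) hl ?_ ?_ (by simp) (by simp) ?_
  · norm_num at h
    linarith
  · intro u _
    have h1 := (hasDerivAt_id' u).sub_const 1
    refine ((((h1.pow 2).const_mul t₁).div_const 2).add
      (((h1.pow 3).const_mul (t₂ - t₁)).div_const 6)).congr_deriv ?_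
    simp
    ring
  · intro u _
    have h1 := (hasDerivAt_id' u).sub_const 1
    refine ((h1.const_mul t₁).add
      (((h1.pow 2).const_mul (t₂ - t₁)).div_const 2)).congr_deriv ?_
    simp
    ring
  · intro u hu
    have hu0 := zero_lt_one.trans_le hu.1
    have e1 := trigamma_tangent_le hc hl hu0 one_pos
    have e2 := trigamma_tangent_le hc hl hu0 two_pos
    have h1 := mul_le_mul_of_nonneg_left e1 (by linarith [hu.2] : 0 ≤ 2 - u)
    have h2 := mul_le_mul_of_nonneg_left e2 (by linarith [hu.1] : 0 ≤ u - 1)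
    simp only [t₁, t₂]
    nlinarith

lemma two_mul_neg_digamma_one_lt (hc : 0 ≤ c) (hl : 0 ≤ l) :
    2 * -digamma c l 1 < trigamma c l 1 := by
  have h1 := neg_digamma_one_le_chord hc hl
  have h2 := trigamma_two c hl
  have h3 := kernel_pos hl one_pos
  linarith

/-! ### The derivative criterion -/

/-- Write `y = 1 / x`. The quantity
`log (y (-ψ y)) + m log Γ y - log (x (-ψ x)) - m log Γ x` vanishes at `x = 1`, and the
hypothesis says that its derivative in `log x` is positive. -/
lemma log_lt_log_of_forall {m : ℝ} (hc : 0 ≤ c) (hl : 0 ≤ l) (hx : 1 < x)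
    (hψ : digamma c l x < 0)
    (h : ∀ s, 1 < s → digamma c l s < 0 →
      2 + m * (s * digamma c l s + 1 / s * digamma c l (1 / s)) <
        s * (trigamma c l s / -digamma c l s) +
          1 / s * (trigamma c l (1 / s) / -digamma c l (1 / s))) :
    log (x * -digamma c l x) + m * logGamma c l x <
      log (1 / x * -digamma c l (1 / x)) + m * logGamma c l (1 / x) := by
  have hmono := digamma_strictMonoOn hc hl
  have hneg : ∀ s ∈ Icc 1 x, digamma c l s < 0 := fun s hs =>
    (hmono.monotoneOn (mem_Ioi.2 (zero_lt_one.trans_le hs.1))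
      (mem_Ioi.2 (zero_lt_one.trans hx)) hs.2).trans_lt hψ
  have hneg' : ∀ s ∈ Icc 1 x, digamma c l (1 / s) < 0 := fun s hs => by
    have hs0 : 0 < s := zero_lt_one.trans_le hs.1
    refine (hmono.monotoneOn (mem_Ioi.2 (by positivity)) (mem_Ioi.2 one_pos) ?_).trans_lt
      (digamma_one_neg hc hl)
    rw [div_le_one hs0]
    exact hs.1
  have key := lt_of_hasDerivAt_pos
    (f := fun s => -2 * log s + (log (-digamma c l (1 / s)) + m * logGamma c l (1 / s)) -
      (log (-digamma c l s) + m * logGamma c l s))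
    (f' := fun s => 1 / s * (s * (trigamma c l s / -digamma c l s) +
          1 / s * (trigamma c l (1 / s) / -digamma c l (1 / s)) -
          (2 + m * (s * digamma c l s + 1 / s * digamma c l (1 / s))))) hx ?_ ?_
  · have hx0 : 0 < x := by linarith
    have e1 := hneg x ⟨hx.le, le_rfl⟩
    have e2 := hneg' x ⟨hx.le, le_rfl⟩
    rw [log_mul hx0.ne' (by linarith), log_mul (by positivity) (by linarith), one_div, log_inv,
      ← one_div]
    simp only [log_one, div_one] at key
    linarith
  · intro s hs
    have hs0 : 0 < s := zero_lt_one.trans_le hs.1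
    have e1 := hneg s hs
    have e2 := hneg' s hs
    have hinv : HasDerivAt (fun s : ℝ => 1 / s) (-(1 / s ^ 2)) s := by
      have := hasDerivAt_inv hs0.ne'
      simpa [one_div] using this
    have hs' : 0 < 1 / s := by positivity
    have d1 := (((hasDerivAt_digamma c hl hs').comp s hinv).neg).log (by simpa using e2.ne)
    have d2 := ((hasDerivAt_logGamma c hl hs').comp s hinv).const_mul m
    have d3 := ((hasDerivAt_digamma c hl hs0).neg).log (by simpa using e1.ne)
    have d4 := (hasDerivAt_logGamma c hl hs0).const_mul m
    refine (((((hasDerivAt_log hs0.ne').const_mul (-2)).add (d1.add d2)).sub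
      (d3.add d4))).congr_deriv ?_
    simp only [Pi.neg_apply, Function.comp_apply]
    have e1' := e1.ne
    have e2' := e2.ne
    field_simp
    ring
  · intro s hs
    have hs0 : 0 < s := zero_lt_one.trans hs.1
    have := h s hs.1 (hneg s (Ioo_subset_Icc_self hs))
    have h2 : 0 < 1 / s := by positivity
    exact mul_pos h2 (sub_pos.2 this)

end Digamma

end QGamma

/-! ### The inequality for `q ≥ 1` -/

namespace QGamma

open Real Set

/-- The pointwise inequality for `q ≥ 1`, in terms of `P = -ψ x`, `Q = -ψ y`, `R = ψ' x`,
`S = ψ' y`, `a = -ψ 1` and `A = ψ' 1 / a`, where `y = 1 / x`. By the arithmetic-geometric mean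
inequality the right-hand side exceeds `2 A`. -/
lemma two_add_lt_of_inverse_square {x y a A P Q R S σ : ℝ} (hx : 1 < x) (hxy : x * y = 1)
    (ha : 0 < a) (hA : 2 < A) (hP : 0 < P) (hQ : 0 < Q) (hPle : P ≤ a * (1 + A * (y - 1)))
    (hQle : Q ≤ a * (1 + A * (x - 1))) (hσ : σ ≤ 2)
    (hR : a * A * exp (-σ * (x - 1)) ≤ R) (hS : a * A * exp (-σ * (y - 1)) ≤ S) :
    2 + (A - 1) * ((x * P + y * Q) / a) < x * (R / P) + y * (S / Q) := by
  have hy : 0 < y := by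
    by_contra! h
    nlinarith
  have hw : 0 < x + y - 2 := by
    have : x * (x + y - 2) = (x - 1) ^ 2 := by linear_combination hxy
    have h2 : 0 < (x - 1) ^ 2 := by
      have : 0 < x - 1 := by linarith
      positivity
    by_contra! h
    nlinarith
  have hRpos : 0 < R := lt_of_lt_of_le (by positivity) hR
  have hSpos : 0 < S := lt_of_lt_of_le (by positivity) hS
  have hRS : a ^ 2 * A ^ 2 * exp (-2 * (x + y - 2)) ≤ R * S := by
    calc _ ≤ a ^ 2 * A ^ 2 * exp (-σ * (x + y - 2)) := by
          gcongr
      _ = a * A * exp (-σ * (x - 1)) * (a * A * exp (-σ * (y - 1))) := by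
          rw [show -σ * (x + y - 2) = -σ * (x - 1) + -σ * (y - 1) by ring, exp_add]
          ring
      _ ≤ R * S := by gcongr
  have hPQ : P * Q < a ^ 2 * exp (-2 * (x + y - 2)) := by
    calc P * Q ≤ a * (1 + A * (y - 1)) * (a * (1 + A * (x - 1))) :=
          mul_le_mul hPle hQle hQ.le (hP.le.trans hPle)
      _ = a ^ 2 * (1 - (A ^ 2 - A) * (x + y - 2)) := by
          linear_combination a ^ 2 * A ^ 2 * hxy
      _ < a ^ 2 * (-2 * (x + y - 2) + 1) := by
          have : 2 * (x + y - 2) < (A ^ 2 - A) * (x + y - 2) := by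
            gcongr
            nlinarith
          have h2 : 0 < a ^ 2 := by positivity
          nlinarith
      _ ≤ _ := by
          gcongr
          exact add_one_le_exp _
  have hprod : A ^ 2 < x * (R / P) * (y * (S / Q)) := by
    have e : x * (R / P) * (y * (S / Q)) = R * S / (P * Q) := by
      rw [show x * (R / P) * (y * (S / Q)) = (x * y) * (R * S / (P * Q)) by ring, hxy, one_mul]
    rw [e, lt_div_iff₀ (by positivity)]
    have : 0 < A ^ 2 := by positivity
    nlinarith
  have hsum : 2 * A < x * (R / P) + y * (S / Q) := by
    have h1 : 0 < x * (R / P) := by positivity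
    have h2 : 0 < y * (S / Q) := by positivity
    nlinarith [sq_nonneg (x * (R / P) - y * (S / Q))]
  have hlin : (x * P + y * Q) / a ≤ 2 := by
    rw [div_le_iff₀ ha]
    have h1 := mul_le_mul_of_nonneg_left hPle (by linarith : 0 ≤ x)
    have h2 := mul_le_mul_of_nonneg_left hQle hy.le
    have h3 : 0 < a * ((A - 1) * (x + y - 2)) :=
      mul_pos ha (mul_pos (by linarith) hw)
    have e : x * (a * (1 + A * (y - 1))) + y * (a * (1 + A * (x - 1))) =
        2 * a - a * ((A - 1) * (x + y - 2)) := by linear_combination 2 * a * A * hxy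
    linarith
  nlinarith

section

variable {l s x : ℝ}

/-- `s² ψ'(s)` is nondecreasing when `c = 2 l`. -/
lemma sq_mul_trigamma_monotoneOn (hl : 0 ≤ l) :
    MonotoneOn (fun s => s ^ 2 * trigamma (2 * l) l s) (Ici (1 / 2)) := by
  intro u hu v _ huv
  have hu' : (1 / 2 : ℝ) ≤ u := hu
  refine le_of_hasDerivAt_nonneg (f := fun s => s ^ 2 * trigamma (2 * l) l s)
    (f' := fun s => s * (2 * trigamma (2 * l) l s + s * trigammaDeriv l s)) huv ?_ ?_
  · intro w hw
    have hw0 : 0 < w := by linarith [hw.1]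
    refine (((hasDerivAt_id' w).pow 2).mul (hasDerivAt_trigamma (2 * l) hl hw0)).congr_deriv ?_
    simp
    ring
  · intro w hw
    have hw0 : 1 / 2 ≤ w := by linarith [hw.1]
    exact mul_nonneg (by linarith) (two_mul_trigamma_add_nonneg hl hw0)

/-- Comparison of `ψ'(s)` with `ψ'(1) / s²` on both sides of `1`, integrated. -/
lemma neg_digamma_le_inverse (hl : 0 ≤ l) (hs : 1 / 2 ≤ s) :
    -digamma (2 * l) l s ≤ -digamma (2 * l) l 1 + trigamma (2 * l) l 1 * (1 / s - 1) := by
  set t := trigamma (2 * l) l 1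
  have hd : ∀ u, 0 < u → HasDerivAt (fun u => digamma (2 * l) l u + t * u⁻¹)
      (trigamma (2 * l) l u - t / u ^ 2) u := fun u hu => by
    refine ((hasDerivAt_digamma (2 * l) hl hu).add
      ((hasDerivAt_inv hu.ne').const_mul t)).congr_deriv ?_
    ring
  rcases le_total 1 s with h | h
  · have := le_of_hasDerivAt_nonneg h (fun u hu => hd u (zero_lt_one.trans_le hu.1))
      (fun u hu => by
        have h1 := sq_mul_trigamma_monotoneOn hl (mem_Ici.2 (by norm_num))
          (mem_Ici.2 (by linarith [hu.1])) hu.1.le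
        have hu0 : 0 < u := zero_lt_one.trans hu.1
        rw [sub_nonneg, div_le_iff₀ (by positivity)]
        simp only [one_pow, one_mul] at h1
        linarith)
    simp only [inv_one, mul_one] at this
    rw [one_div]
    linarith
  · have hs0 : 0 < s := by linarith
    have := le_of_hasDerivAt_nonpos h (fun u hu => hd u (hs0.trans_le hu.1))
      (fun u hu => by
        have h1 := sq_mul_trigamma_monotoneOn hl (mem_Ici.2 (by linarith [hu.1]))
          (mem_Ici.2 (by norm_num)) hu.2.le
        have hu0 : 0 < u := hs0.trans hu.1
        rw [sub_nonpos, le_div_iff₀ (by positivity)]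
        simp only [one_pow, one_mul] at h1
        linarith)
    simp only [inv_one, mul_one] at this
    rw [one_div]
    linarith

/-- The derivative criterion holds for `q ≥ 1` with the critical exponent. -/
lemma criterion_of_one_le (hl : 0 ≤ l) (hx : 1 < x) (hψ : digamma (2 * l) l x < 0) :
    2 + (-digamma (2 * l) l 1 - trigamma (2 * l) l 1) / digamma (2 * l) l 1 ^ 2 *
        (x * digamma (2 * l) l x + 1 / x * digamma (2 * l) l (1 / x)) <
      x * (trigamma (2 * l) l x / -digamma (2 * l) l x) +
        1 / x * (trigamma (2 * l) l (1 / x) / -digamma (2 * l) l (1 / x)) := by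
  have hc : 0 ≤ 2 * l := by positivity
  have hx0 : 0 < x := by linarith
  have hx2 := lt_three_halves hc hl hx0 hψ
  have ha : 0 < -digamma (2 * l) l 1 := neg_pos.2 (digamma_one_neg hc hl)
  have hy0 : 0 < 1 / x := by positivity
  have hy1 : 1 / x < 1 := by rw [div_lt_one hx0]; exact hx
  have hy2 : 1 / 2 ≤ 1 / x := one_div_le_one_div_of_le hx0 (by linarith)
  have hQ : digamma (2 * l) l (1 / x) < digamma (2 * l) l 1 :=
    digamma_strictMonoOn hc hl hy0 (mem_Ioi.2 one_pos) hy1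
  have hA := two_mul_neg_digamma_one_lt hc hl
  have hD := trigamma_pos hc hl one_pos
  set a := -digamma (2 * l) l 1 with ha'
  set D := trigamma (2 * l) l 1 with hD'
  have hAD : a * (D / a) = D := mul_div_cancel₀ _ ha.ne'
  have key := two_add_lt_of_inverse_square (x := x) (y := 1 / x) (a := a) (A := D / a)
    (P := -digamma (2 * l) l x) (Q := -digamma (2 * l) l (1 / x)) (R := trigamma (2 * l) l x)
    (S := trigamma (2 * l) l (1 / x)) (σ := -(trigammaDeriv l 1 / D)) hx (by field_simp) ha
    (by rw [lt_div_iff₀ ha]; linarith) (by linarith) (by linarith)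
    (by
      have := neg_digamma_le_inverse hl (by linarith : 1 / 2 ≤ x)
      rw [mul_add, ← mul_assoc, hAD]
      linarith)
    (by
      have := neg_digamma_le_inverse hl hy2
      rw [one_div_one_div] at this
      rw [mul_add, ← mul_assoc, hAD]
      linarith)
    (by
      have := two_mul_trigamma_add_nonneg hl (by norm_num : (1 / 2 : ℝ) ≤ 1)
      rw [← neg_div, div_le_iff₀ hD]
      linarith)
    (by
      rw [hAD, neg_neg]
      exact trigamma_mul_exp_le hc hl one_pos hx0)
    (by
      rw [hAD, neg_neg]
      exact trigamma_mul_exp_le hc hl one_pos hy0)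
  refine lt_of_eq_of_lt ?_ key
  have e : digamma (2 * l) l 1 = -a := by rw [ha', neg_neg]
  rw [e]
  field_simp
  ring

end

/-! ### The inequality for `q < 1` -/

/-- The pointwise inequality for `q < 1` and moderate `l`, in the notation of
`two_add_lt_of_inverse_square` and with `d = x - 1`. The hypothesis `hRP` comes from the location
of the zero of `ψ`, and `hRA` from the exponential lower bound for `ψ'` on `[1, x]`. -/
lemma two_add_lt_of_moderate {d a A P Q R S : ℝ} (hd : 0 < d) (hd2 : d < 1 / 2) (ha : 0 < a)
    (hA : 12 / 5 ≤ A) (hP : 0 < P) (hQ : 0 < Q) (hPa : (1 + d) * P ≤ a)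
    (hQle : Q ≤ a * (1 + A * (d * (1 + 2 * d)))) (hRA : A * P ≤ R)
    (hRP : P ≤ R * (1 / 2 - d)) (hS : a * A ≤ S) :
    2 + ((1 + d) * P + 1 / (1 + d) * Q) / a < (1 + d) * (R / P) + 1 / (1 + d) * (S / Q) := by
  set e := d * (1 + 2 * d) with he
  have he0 : 0 < e := by positivity
  set B := R / P with hB
  have hBA : A ≤ B := by rw [hB, le_div_iff₀ hP]; exact hRA
  have hBd : 2 / (1 - 2 * d) ≤ B := by
    rw [hB, div_le_div_iff₀ (by linarith) hP]
    linarith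
  have hSQ : A / (1 + A * e) ≤ S / Q := by
    rw [div_le_div_iff₀ (by positivity) hQ]
    calc A * Q ≤ A * (a * (1 + A * e)) := by gcongr
      _ = a * A * (1 + A * e) := by ring
      _ ≤ S * (1 + A * e) := by gcongr
  have hmono : 12 / 5 / (1 + 12 / 5 * e) ≤ A / (1 + A * e) := by
    rw [div_le_div_iff₀ (by positivity) (by positivity)]
    nlinarith
  -- the remaining inequality involves `d` only
  have hpoly : 4 + 3 * d < (1 + d - d ^ 2) * (2 / (1 - 2 * d)) + 12 / 5 / (1 + 12 / 5 * e) := by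
    have h1 : 0 < 1 - 2 * d := by linarith
    have h2 : 0 < 1 + 12 / 5 * e := by positivity
    rw [mul_div_assoc', div_add_div _ _ h1.ne' h2.ne', lt_div_iff₀ (by positivity), he]
    nlinarith [sq_nonneg (d - 13 / 112), pow_pos hd 3, pow_pos hd 4]
  have hmain : (1 + d - d ^ 2) * (2 / (1 - 2 * d)) ≤ (1 + d) ^ 2 * B - A * e := by
    have h1 : 0 ≤ 1 + d - d ^ 2 := by nlinarith
    have h2 := mul_le_mul_of_nonneg_left hBd h1
    have h3 : A * e ≤ B * e := by gcongr
    have h4 : (1 + d) ^ 2 - e = 1 + d - d ^ 2 := by rw [he]; ring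
    nlinarith
  have hPa' : (1 + d) * P / a ≤ 1 := (div_le_one ha).2 hPa
  have hQa' : Q / a ≤ 1 + A * e := by rw [div_le_iff₀ ha]; linarith
  have h1d : 0 < 1 + d := by linarith
  have hfin : (1 + d) * (2 + ((1 + d) * P + 1 / (1 + d) * Q) / a) <
      (1 + d) * ((1 + d) * B + 1 / (1 + d) * (S / Q)) := by
    have e1 : (1 + d) * (2 + ((1 + d) * P + 1 / (1 + d) * Q) / a) =
        2 * (1 + d) + (1 + d) * ((1 + d) * P / a) + Q / a := by field_simp; ring
    have e2 : (1 + d) * ((1 + d) * B + 1 / (1 + d) * (S / Q)) = (1 + d) ^ 2 * B + S / Q := by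
      field_simp
    rw [e1, e2]
    have := mul_le_mul_of_nonneg_left hPa' h1d.le
    linarith
  exact lt_of_mul_lt_mul_left hfin h1d.le

/-- The pointwise inequality for `q < 1` and large `l`, in the notation of
`two_add_lt_of_inverse_square` and with `d = x - 1`, `L = 2 l`, `σ = 2 l coth l` and
`E = (e ^ (σ d) - 1) / σ`. -/
lemma two_add_lt_of_large {d a A P Q R S L σ E : ℝ} (hd : 0 < d) (ha : 0 < a) (hL : 2 ≤ L)
    (hLσ : L ≤ σ) (hσA : σ + 1 / 2 ≤ A) (hE : 0 ≤ E) (hP : 0 < P) (hQ : 0 < Q)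
    (hPa : (1 + d) * P ≤ a) (hPle : (1 + σ * E) * P ≤ a * (1 - (A - σ) * E))
    (hR : a * A ≤ (1 + σ * E) * R) (hQle : Q ≤ a * (1 + A * E))
    (hS : a * A + L * (Q - a) ≤ S) :
    2 + ((1 + d) * P + 1 / (1 + d) * Q) / a < (1 + d) * (R / P) + 1 / (1 + d) * (S / Q) := by
  have hσE : 0 < 1 + σ * E := by
    have : 0 ≤ σ := by linarith
    positivity
  have hτ : 0 < 1 - (A - σ) * E := by
    have : 0 < a * (1 - (A - σ) * E) := lt_of_lt_of_le (by positivity) hPle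
    exact pos_of_mul_pos_right this ha.le
  have hA : 5 / 2 ≤ A := by linarith
  set B := R / P with hB
  have hBτ : A ≤ B * (1 - (A - σ) * E) := by
    rw [hB, div_mul_eq_mul_div, le_div_iff₀ hP]
    have h1 := mul_le_mul_of_nonneg_left hPle (by linarith : 0 ≤ A)
    have h2 := mul_le_mul_of_nonneg_right hR hτ.le
    have h3 : (1 + σ * E) * (A * P) ≤ (1 + σ * E) * (R * (1 - (A - σ) * E)) := by linarith
    exact le_of_mul_le_mul_left h3 hσE
  have hB0 : 0 < B := by
    by_contra! h
    nlinarith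
  have hBA : A ≤ B := by
    have : 0 ≤ B * ((A - σ) * E) := mul_nonneg hB0.le (mul_nonneg (by linarith) hE)
    linarith
  set v := 1 - E / 2 with hv
  have hvτ : 1 - (A - σ) * E ≤ v := by
    have := mul_le_mul_of_nonneg_right (by linarith : 1 / 2 ≤ A - σ) hE
    linarith
  have hv0 : 0 < v := hτ.trans_le hvτ
  have hBE : 4 / 5 * A < B - A * E := by
    have h1 : A ≤ B * v := hBτ.trans (by gcongr)
    have h2 : A * v * (4 / 5 + E) < A := by
      have : v * (4 / 5 + E) < 1 := by
        rw [hv]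
        nlinarith [sq_nonneg (E - 3 / 5)]
      nlinarith
    have h3 : v * (4 / 5 * A + A * E) < v * B := by linarith
    linarith [lt_of_mul_lt_mul_left h3 hv0.le]
  have hSQ : L ≤ S / Q := by
    rw [le_div_iff₀ hQ]
    have : 0 ≤ a * (A - L) := mul_nonneg ha.le (by linarith)
    linarith
  have hPa' : (1 + d) * P / a ≤ 1 := (div_le_one ha).2 hPa
  have hQa' : Q / a ≤ 1 + A * E := by rw [div_le_iff₀ ha]; linarith
  have h1d : 0 < 1 + d := by linarith
  have hxB : 3 * d ≤ (1 + d) ^ 2 * B - B := by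
    nlinarith [mul_pos hd hB0, mul_pos (mul_pos hd hd) hB0]
  have hfin : (1 + d) * (2 + ((1 + d) * P + 1 / (1 + d) * Q) / a) <
      (1 + d) * ((1 + d) * B + 1 / (1 + d) * (S / Q)) := by
    have e1 : (1 + d) * (2 + ((1 + d) * P + 1 / (1 + d) * Q) / a) =
        2 * (1 + d) + (1 + d) * ((1 + d) * P / a) + Q / a := by field_simp; ring
    have e2 : (1 + d) * ((1 + d) * B + 1 / (1 + d) * (S / Q)) = (1 + d) ^ 2 * B + S / Q := by
      field_simp
    rw [e1, e2]
    have := mul_le_mul_of_nonneg_left hPa' h1d.le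
    linarith
  exact lt_of_mul_lt_mul_left hfin h1d.le

end QGamma

/-! ### Exponential comparison of the trigamma function for `q < 1` -/

namespace QGamma

open Real Set

section

variable {c l s x y : ℝ}

lemma hasDerivAt_trigamma_mul_exp (c B : ℝ) (hl : 0 ≤ l) (hs : 0 < s) :
    HasDerivAt (fun s => trigamma c l s * exp (B * s))
      ((trigammaDeriv l s + B * trigamma c l s) * exp (B * s)) s := by
  have h1 : HasDerivAt (fun s : ℝ => B * s) B s := by
    simpa using (hasDerivAt_id' s).const_mul B
  refine ((hasDerivAt_trigamma c hl hs).mul h1.exp).congr_deriv ?_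
  ring

lemma trigamma_one_mul_exp_le (hl : 0 ≤ l) (hs : 1 ≤ s) :
    trigamma 0 l 1 * exp (-(2 * scaledCoth l 1) * (s - 1)) ≤ trigamma 0 l s := by
  set σ := 2 * scaledCoth l 1
  have h := le_of_hasDerivAt_nonneg hs
    (fun u hu => hasDerivAt_trigamma_mul_exp 0 σ hl (zero_lt_one.trans_le hu.1))
    (fun u hu => by
      have := trigammaDeriv_ge_at_one le_rfl hl hu.1.le
      exact mul_nonneg (by linarith) (exp_pos _).le)
  calc _ = trigamma 0 l 1 * exp (σ * 1) * exp (-(σ * s)) := by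
        rw [mul_assoc, ← exp_add]; ring_nf
    _ ≤ trigamma 0 l s * exp (σ * s) * exp (-(σ * s)) := by gcongr
    _ = _ := by rw [mul_assoc, ← exp_add]; simp

lemma trigamma_le_one_mul_exp (hl : 0 ≤ l) (hs : 1 ≤ s) :
    trigamma 0 l s ≤ trigamma 0 l 1 * exp (-(2 * l) * (s - 1)) := by
  have h := le_of_hasDerivAt_nonpos hs
    (fun u hu => hasDerivAt_trigamma_mul_exp 0 (2 * l) hl (zero_lt_one.trans_le hu.1))
    (fun u hu => by
      have := trigammaDeriv_le hl (zero_lt_one.trans hu.1)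
      exact mul_nonpos_of_nonpos_of_nonneg (by linarith) (exp_pos _).le)
  calc _ = trigamma 0 l s * exp (2 * l * s) * exp (-(2 * l * s)) := by
        rw [mul_assoc, ← exp_add]; simp
    _ ≤ trigamma 0 l 1 * exp (2 * l * 1) * exp (-(2 * l * s)) := by gcongr
    _ = _ := by rw [mul_assoc, ← exp_add]; ring_nf

lemma trigamma_le_exp_div_sq (hl : 0 ≤ l) (hs : 0 < s) (hs1 : s ≤ 1) :
    trigamma 0 l s ≤ trigamma 0 l 1 * exp (2 * l * (1 - s)) / s ^ 2 := by
  have h := le_of_hasDerivAt_nonneg (f := fun s => trigamma 0 l s * exp (2 * l * s) * s ^ 2)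
    (f' := fun s => (trigammaDeriv l s + (2 * l + 2 / s) * trigamma 0 l s) *
      (exp (2 * l * s) * s ^ 2)) hs1
    (fun u hu => by
      have hu0 : 0 < u := hs.trans_le hu.1
      refine ((hasDerivAt_trigamma_mul_exp 0 (2 * l) hl hu0).mul
        ((hasDerivAt_id' u).pow 2)).congr_deriv ?_
      simp
      field_simp
      ring)
    (fun u hu => by
      have := trigammaDeriv_ge_add le_rfl hl (hs.trans hu.1)
      exact mul_nonneg (by linarith) (by positivity))
  rw [le_div_iff₀ (by positivity)]
  calc _ = trigamma 0 l s * exp (2 * l * s) * s ^ 2 * exp (-(2 * l * s)) := by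
        rw [mul_assoc _ (s ^ 2), mul_comm (s ^ 2), ← mul_assoc, mul_assoc _ (exp _) (exp _),
          ← exp_add]
        simp
    _ ≤ trigamma 0 l 1 * exp (2 * l * 1) * 1 ^ 2 * exp (-(2 * l * s)) := by gcongr
    _ = _ := by
        rw [one_pow, mul_one, mul_assoc, ← exp_add]; ring_nf

/-- The lower exponential bound for `ψ'` to the right of `1`, integrated. -/
lemma neg_digamma_le_right (hl : 0 ≤ l) (hx : 1 ≤ x) :
    -digamma 0 l x ≤ -digamma 0 l 1 - trigamma 0 l 1 *
      ((1 - exp (-(2 * scaledCoth l 1) * (x - 1))) / (2 * scaledCoth l 1)) := by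
  set σ := 2 * scaledCoth l 1 with hσ
  have hσ0 : 0 < σ := by have := scaledCoth_pos hl one_pos; positivity
  have h := le_of_hasDerivAt_nonneg
    (f := fun s => digamma 0 l s + trigamma 0 l 1 * (exp (-σ * (s - 1)) / σ))
    (f' := fun s => trigamma 0 l s - trigamma 0 l 1 * exp (-σ * (s - 1))) hx
    (fun u hu => by
      have h1 : HasDerivAt (fun s : ℝ => -σ * (s - 1)) (-σ) u := by
        simpa using ((hasDerivAt_id' u).sub_const 1).const_mul (-σ)
      refine ((hasDerivAt_digamma 0 hl (zero_lt_one.trans_le hu.1)).add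
        ((h1.exp.div_const σ).const_mul (trigamma 0 l 1))).congr_deriv ?_
      field_simp
      ring)
    (fun u hu => sub_nonneg.2 (trigamma_one_mul_exp_le hl hu.1.le))
  simp only [sub_self, mul_zero, exp_zero] at h
  rw [sub_div, mul_sub]
  linarith

/-- The upper bound for `ψ'` to the left of `1`, integrated with the exponential factor
frozen. -/
lemma neg_digamma_le_left (hl : 0 ≤ l) (hy : 0 < y) (hy1 : y ≤ 1) :
    -digamma 0 l y ≤ -digamma 0 l 1 +
      trigamma 0 l 1 * ((1 / y - 1) * exp (2 * l * (1 - y))) := by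
  set K := trigamma 0 l 1 * exp (2 * l * (1 - y)) with hK
  have hD := trigamma_pos le_rfl hl one_pos
  have h := le_of_hasDerivAt_nonpos (f := fun s => digamma 0 l s + K * s⁻¹)
    (f' := fun s => trigamma 0 l s - K / s ^ 2) hy1
    (fun u hu => by
      have hu0 : 0 < u := hy.trans_le hu.1
      refine ((hasDerivAt_digamma 0 hl hu0).add
        ((hasDerivAt_inv hu0.ne').const_mul K)).congr_deriv ?_
      ring)
    (fun u hu => by
      have hu0 : 0 < u := hy.trans hu.1
      refine sub_nonpos.2 ((trigamma_le_exp_div_sq hl hu0 hu.2.le).trans ?_)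
      have := hu.1.le
      rw [hK]
      gcongr)
  simp only [inv_one, mul_one] at h
  have e : trigamma 0 l 1 * ((1 / y - 1) * exp (2 * l * (1 - y))) = K * y⁻¹ - K := by
    rw [hK, one_div]; ring
  rw [e]
  linarith

/-- The upper bound for `ψ'` to the left of `1`, integrated in a form which mirrors the bound to
the right of `1` under `x ↦ 1 / x`. -/
lemma neg_digamma_le_left' (hl : 0 ≤ l) (hy : 0 < y) (hy1 : y ≤ 1) :
    -digamma 0 l y ≤ -digamma 0 l 1 + trigamma 0 l 1 *
      ((exp (2 * scaledCoth l 1 * (1 / y - 1)) - 1) / (2 * scaledCoth l 1)) := by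
  set σ := 2 * scaledCoth l 1 with hσ
  have hσ0 : 0 < σ := by have := scaledCoth_pos hl one_pos; positivity
  have hlσ : 2 * l ≤ σ := by linarith [le_scaledCoth hl one_pos]
  have hD := trigamma_pos le_rfl hl one_pos
  have h := le_of_hasDerivAt_nonpos
    (f := fun s => digamma 0 l s + trigamma 0 l 1 * (exp (σ * (s⁻¹ - 1)) / σ))
    (f' := fun s => trigamma 0 l s - trigamma 0 l 1 * exp (σ * (s⁻¹ - 1)) / s ^ 2) hy1
    (fun u hu => by
      have hu0 : 0 < u := hy.trans_le hu.1
      have h1 := ((hasDerivAt_inv hu0.ne').sub_const 1).const_mul σ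
      refine ((hasDerivAt_digamma 0 hl hu0).add
        ((h1.exp.div_const σ).const_mul (trigamma 0 l 1))).congr_deriv ?_
      field_simp
      ring)
    (fun u hu => by
      have hu0 : 0 < u := hy.trans hu.1
      refine sub_nonpos.2 ((trigamma_le_exp_div_sq hl hu0 hu.2.le).trans ?_)
      have h1 : 1 - u ≤ u⁻¹ - 1 := by
        have : u * (u⁻¹ - 1 - (1 - u)) = (u - 1) ^ 2 := by field_simp; ring
        by_contra! h2
        nlinarith [sq_nonneg (u - 1)]
      have h2 : 0 ≤ 1 - u := by linarith [hu.2]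
      gcongr)
  simp only [inv_one, sub_self, mul_zero, exp_zero] at h
  rw [one_div y, sub_div, mul_sub]
  linarith

lemma trigamma_add_digamma_antitoneOn (hl : 0 ≤ l) :
    AntitoneOn (fun s => trigamma 0 l s + 2 * l * digamma 0 l s) (Ioi 0) :=
  fun u hu _ _ huv => le_of_hasDerivAt_nonpos huv
    (fun _ hw => (hasDerivAt_trigamma 0 hl (lt_of_lt_of_le hu hw.1)).add
      ((hasDerivAt_digamma 0 hl (lt_of_lt_of_le hu hw.1)).const_mul (2 * l)))
    (fun _ hw => by linarith [trigammaDeriv_le hl (lt_trans hu hw.1)])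

lemma mul_neg_digamma_le (hc : 0 ≤ c) (hl : 0 ≤ l) (hx : 1 ≤ x) :
    x * -digamma c l x ≤ -digamma c l 1 := by
  have h := le_of_hasDerivAt_nonneg (f := fun s => s * digamma c l s)
    (f' := fun s => 1 * digamma c l s + s * trigamma c l s) hx
    (fun u hu => (hasDerivAt_id' u).mul (hasDerivAt_digamma c hl (zero_lt_one.trans_le hu.1)))
    (fun u hu => by
      have hu0 := zero_lt_one.trans hu.1
      have h1 := neg_digamma_le (c := c) hl hu0
      have h2 := trigamma_pos hc hl hu0
      nlinarith [hu.1])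
  linarith

/-! ### Lower bounds for `ψ' 1 / (-ψ 1)` for `q < 1` -/

lemma twelve_fifths_mul_le (hl : 0 ≤ l) : 12 / 5 * -digamma 0 l 1 ≤ trigamma 0 l 1 := by
  linarith [neg_digamma_one_le_chord le_rfl hl, trigamma_two_le hl]

lemma sq_mul_neg_digamma_one_le (hl : 0 < l) :
    (2 * l) ^ 2 * -digamma 0 l 1 ≤ trigamma 0 l 1 * (2 * l - 1 + exp (-(2 * l))) := by
  set L := 2 * l with hL
  have hL0 : 0 < L := by positivity
  set t := trigamma 0 l 1
  have hexp : ∀ u : ℝ, HasDerivAt (fun u => exp (-L * (u - 1))) (-L * exp (-L * (u - 1))) u := by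
    intro u
    have h1 : HasDerivAt (fun s : ℝ => -L * (s - 1)) (-L) u := by
      simpa using ((hasDerivAt_id' u).sub_const 1).const_mul (-L)
    refine h1.exp.congr_deriv ?_
    ring
  have h := neg_digamma_one_le (c := 0) (l := l)
    (B := fun u => t * ((L * (u - 1) - 1 + exp (-L * (u - 1))) / L ^ 2))
    (B' := fun u => t * ((1 - exp (-L * (u - 1))) / L))
    (B'' := fun u => t * exp (-L * (u - 1))) hl.le ?_ ?_ (by simp) (by simp) ?_
  · rw [mul_div_assoc', le_div_iff₀ (by positivity)] at h
    norm_num at h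
    linarith
  · intro u _
    refine (((((((hasDerivAt_id' u).sub_const 1).const_mul L).sub_const 1).add
      (hexp u)).div_const (L ^ 2)).const_mul t).congr_deriv ?_
    field_simp
    ring
  · intro u _
    refine ((((hexp u).const_sub 1).div_const L).const_mul t).congr_deriv ?_
    field_simp
  · intro u hu
    exact trigamma_le_one_mul_exp hl.le hu.1

lemma two_mul_scaledCoth_mul (hl : 0 < l) :
    2 * scaledCoth l 1 * (1 - exp (-(2 * l))) = 2 * l * (1 + exp (-(2 * l))) := by
  have hS : 0 < sinh l := sinh_pos_iff.2 hl
  have h1 : 1 - exp (-(2 * l)) = 2 * exp (-l) * sinh l := by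
    rw [sinh_eq, show -(2 * l) = -l + -l by ring, exp_add]
    have : exp (-l) * exp l = 1 := by rw [← exp_add]; simp
    linear_combination -this
  have h2 : 1 + exp (-(2 * l)) = 2 * exp (-l) * cosh l := by
    rw [cosh_eq, show -(2 * l) = -l + -l by ring, exp_add]
    have : exp (-l) * exp l = 1 := by rw [← exp_add]; simp
    linear_combination -this
  rw [h1, h2, scaledCoth, scaledSinh, if_neg hl.ne', mul_one]
  field_simp

lemma exp_neg_add_pos {L : ℝ} (hL : 0 < L) : 0 < L - 1 + exp (-L) := by
  have := add_one_lt_exp (neg_ne_zero.2 hL.ne')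
  linarith

/-- `2 l coth l`, which bounds `-ψ'' / ψ'` on `[1, ∞)`, is at most `ψ' 1 / (-ψ 1)`. -/
lemma scaledCoth_mul_le (hl : 0 < l) :
    2 * scaledCoth l 1 * -digamma 0 l 1 ≤ trigamma 0 l 1 := by
  have h1 := sq_mul_neg_digamma_one_le hl
  have h2 := two_mul_scaledCoth_mul hl
  have ha := neg_pos.2 (digamma_one_neg le_rfl hl.le)
  set a := -digamma 0 l 1
  set L := 2 * l with hL
  have hL0 : 0 < L := by positivity
  set p := exp (-L) with hp
  have hp1 : p < 1 := exp_lt_one_iff.2 (by linarith)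
  have hpos := exp_neg_add_pos hL0
  -- this is `L ≤ sinh L`
  have h3 : 2 * L * p ≤ 1 - p ^ 2 := by
    have h4 := self_le_sinh_iff.2 hL0.le
    have h5 : p * exp L = 1 := by rw [hp, ← exp_add]; simp
    rw [sinh_eq] at h4
    have h6 := mul_le_mul_of_nonneg_right h4 (exp_pos (-L)).le
    rw [← hp] at h6
    nlinarith
  have h4 : 2 * scaledCoth l 1 * (L - 1 + p) ≤ L ^ 2 := by
    have h5 : (1 - p) * (2 * scaledCoth l 1 * (L - 1 + p)) ≤ (1 - p) * L ^ 2 := by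
      have e : (1 - p) * (2 * scaledCoth l 1 * (L - 1 + p)) = L * (1 + p) * (L - 1 + p) := by
        linear_combination (L - 1 + p) * h2
      rw [e]
      nlinarith
    exact le_of_mul_le_mul_left h5 (by linarith)
  have h5 : (L - 1 + p) * (2 * scaledCoth l 1 * a) ≤ (L - 1 + p) * trigamma 0 l 1 := by
    nlinarith
  exact le_of_mul_le_mul_left h5 hpos

lemma scaledCoth_add_half_mul_le (hl : 1 ≤ l) :
    (2 * scaledCoth l 1 + 1 / 2) * -digamma 0 l 1 ≤ trigamma 0 l 1 := by
  have hl0 : 0 < l := by linarith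
  have h1 := sq_mul_neg_digamma_one_le hl0
  have h2 := two_mul_scaledCoth_mul hl0
  have ha := neg_pos.2 (digamma_one_neg le_rfl hl0.le)
  set a := -digamma 0 l 1
  set L := 2 * l with hL
  have hL0 : 2 ≤ L := by linarith
  set p := exp (-L) with hp
  have hp0 : 0 < p := exp_pos _
  have hp1 : p < 1 := exp_lt_one_iff.2 (by linarith)
  have hpos := exp_neg_add_pos (by linarith : 0 < L)
  -- `e ^ (L / 2) ≥ e L / 2`, squared
  have hpL : p * L ^ 2 ≤ 11 / 20 := by
    have h3 : L / 2 ≤ exp (L / 2 - 1) := by linarith [add_one_le_exp (L / 2 - 1)]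
    have h4 : L ^ 2 / 4 ≤ exp (L - 2) := by
      have := pow_le_pow_left₀ (by positivity) h3 2
      rw [← exp_nat_mul] at this
      rw [show L - 2 = ((2 : ℕ) : ℝ) * (L / 2 - 1) by push_cast; ring]
      linarith
    have h5 : p * exp (L - 2) = exp (-1) ^ 2 := by
      rw [hp, ← exp_add, ← exp_nat_mul]; congr 1; push_cast; ring
    have h6 : exp (-1) < 0.37 := by linarith [exp_neg_one_lt_d9]
    have h7 : exp (-1) ^ 2 ≤ 0.37 ^ 2 := pow_le_pow_left₀ (exp_pos _).le h6.le 2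
    have h8 := mul_le_mul_of_nonneg_left h4 hp0.le
    rw [h5] at h8
    norm_num at h7
    linarith
  have hp2 : p ≤ 11 / 80 := by
    have : p * 2 ^ 2 ≤ p * L ^ 2 := by gcongr
    linarith
  have h4 : (2 * scaledCoth l 1 + 1 / 2) * (L - 1 + p) ≤ L ^ 2 := by
    have h5 : (1 - p) * ((2 * scaledCoth l 1 + 1 / 2) * (L - 1 + p)) ≤ (1 - p) * L ^ 2 := by
      have e : (1 - p) * ((2 * scaledCoth l 1 + 1 / 2) * (L - 1 + p)) =
          (L * (1 + p) + (1 - p) / 2) * (L - 1 + p) := by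
        linear_combination (L - 1 + p) * h2
      rw [e]
      have h6 : 1 / 2 ≤ (1 - p) * (1 / 2 + p) := by nlinarith
      have h7 : 2 * (1 / 2) ≤ L * ((1 - p) * (1 / 2 + p)) :=
        mul_le_mul hL0 h6 (by norm_num) (by linarith)
      have h8 : 1 / 3 ≤ (1 - p) ^ 2 / 2 := by nlinarith
      nlinarith
    exact le_of_mul_le_mul_left h5 (by linarith)
  have h5 : (L - 1 + p) * ((2 * scaledCoth l 1 + 1 / 2) * a) ≤
      (L - 1 + p) * trigamma 0 l 1 := by
    nlinarith
  exact le_of_mul_le_mul_left h5 hpos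

/-- The derivative criterion holds for `q < 1` with exponent `1 / ψ 1`. -/
lemma criterion_of_lt_one (hl : 0 < l) (hx : 1 < x) (hψ : digamma 0 l x < 0) :
    2 + 1 / digamma 0 l 1 * (x * digamma 0 l x + 1 / x * digamma 0 l (1 / x)) <
      x * (trigamma 0 l x / -digamma 0 l x) +
        1 / x * (trigamma 0 l (1 / x) / -digamma 0 l (1 / x)) := by
  have hx0 : 0 < x := by linarith
  have hx2 := lt_three_halves le_rfl hl.le hx0 hψ
  have ha : 0 < -digamma 0 l 1 := neg_pos.2 (digamma_one_neg le_rfl hl.le)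
  have hy0 : 0 < 1 / x := by positivity
  have hy1 : 1 / x < 1 := by rw [div_lt_one hx0]; exact hx
  have hQ : digamma 0 l (1 / x) < digamma 0 l 1 :=
    digamma_strictMonoOn le_rfl hl.le hy0 (mem_Ioi.2 one_pos) hy1
  have hD := trigamma_pos le_rfl hl.le one_pos
  have hPa := mul_neg_digamma_le le_rfl hl.le hx.le
  have hright := neg_digamma_le_right hl.le hx.le
  have hRge := trigamma_one_mul_exp_le hl.le hx.le
  have hσa := scaledCoth_mul_le hl
  have hσ0 : 0 < 2 * scaledCoth l 1 := by
    have := scaledCoth_pos hl.le one_pos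
    positivity
  have hgoal : 2 + ((1 + (x - 1)) * -digamma 0 l x +
      1 / (1 + (x - 1)) * -digamma 0 l (1 / x)) / -digamma 0 l 1 <
      (1 + (x - 1)) * (trigamma 0 l x / -digamma 0 l x) +
        1 / (1 + (x - 1)) * (trigamma 0 l (1 / x) / -digamma 0 l (1 / x)) := by
    have hAD : -digamma 0 l 1 * (trigamma 0 l 1 / -digamma 0 l 1) = trigamma 0 l 1 :=
      mul_div_cancel₀ _ ha.ne'
    rcases le_total l 1 with h1 | h1
    · refine two_add_lt_of_moderate (A := trigamma 0 l 1 / -digamma 0 l 1) (by linarith)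
        (by linarith) ha ?_ (by linarith) (by linarith) (by linarith) ?_ ?_ ?_ ?_
      · rw [le_div_iff₀ ha]
        exact twelve_fifths_mul_le hl.le
      · rw [mul_add, ← mul_assoc, hAD, mul_one]
        refine (neg_digamma_le_left hl.le hy0 hy1.le).trans ?_
        rw [one_div_one_div]
        have hexp : exp (2 * l * (1 - 1 / x)) ≤ 1 + 2 * (x - 1) := by
          rw [← le_log_iff_exp_le (by linarith)]
          refine le_trans ?_ (le_log_one_add_of_nonneg (by linarith : 0 ≤ 2 * (x - 1)))
          rw [le_div_iff₀ (by linarith)]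
          have e : 2 * l * (1 - 1 / x) * (2 * (x - 1) + 2) = 4 * l * (x - 1) := by
            field_simp; ring
          rw [e]
          nlinarith
        have : 0 ≤ x - 1 := by linarith
        gcongr
      · rw [div_mul_eq_mul_div, div_le_iff₀ ha]
        set σ := 2 * scaledCoth l 1
        set e := exp (-σ * (x - 1)) with he
        have he1 : e ≤ 1 := exp_le_one_iff.2 (by nlinarith)
        have h2 : -digamma 0 l 1 * (1 - e) ≤ trigamma 0 l 1 * ((1 - e) / σ) := by
          rw [mul_div_assoc', le_div_iff₀ hσ0]
          nlinarith
        have h3 : -digamma 0 l x ≤ -digamma 0 l 1 * e := by linarith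
        calc _ ≤ trigamma 0 l 1 * (-digamma 0 l 1 * e) := by gcongr
          _ = trigamma 0 l 1 * e * -digamma 0 l 1 := by ring
          _ ≤ _ := by gcongr
      · have := neg_digamma_le (c := 0) hl.le hx0
        linarith
      · rw [hAD]
        exact trigamma_antitoneOn hl.le hy0 (mem_Ioi.2 one_pos) hy1.le
    · set σ := 2 * scaledCoth l 1 with hσ
      set E := (exp (σ * (x - 1)) - 1) / σ with hE
      have hσE : 1 + σ * E = exp (σ * (x - 1)) := by
        rw [hE]; field_simp; ring
      have hexp : exp (σ * (x - 1)) * exp (-σ * (x - 1)) = 1 := by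
        rw [← exp_add]; simp
      refine two_add_lt_of_large (A := trigamma 0 l 1 / -digamma 0 l 1) (L := 2 * l) (σ := σ)
        (E := E) (by linarith) ha (by linarith) ?_ ?_ ?_ (by linarith) (by linarith)
        (by linarith) ?_ ?_ ?_ ?_
      · linarith [le_scaledCoth hl.le one_pos]
      · rw [le_div_iff₀ ha]
        exact scaledCoth_add_half_mul_le h1
      · have : 1 ≤ exp (σ * (x - 1)) := one_le_exp (mul_nonneg hσ0.le (by linarith))
        exact div_nonneg (by linarith) hσ0.le
      · have e1 : -digamma 0 l 1 * (1 - (trigamma 0 l 1 / -digamma 0 l 1 - σ) * E) =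
            -digamma 0 l 1 * (1 + σ * E) - trigamma 0 l 1 * E := by
          linear_combination -E * hAD
        have h2 := mul_le_mul_of_nonneg_left hright (exp_pos (σ * (x - 1))).le
        have e2 : exp (σ * (x - 1)) * (-digamma 0 l 1 - trigamma 0 l 1 *
            ((1 - exp (-σ * (x - 1))) / σ)) =
            -digamma 0 l 1 * exp (σ * (x - 1)) - trigamma 0 l 1 * E := by
          rw [hE]
          linear_combination trigamma 0 l 1 / σ * hexp
        rw [e1, hσE]
        linarith
      · rw [hAD, hσE]
        have h2 := mul_le_mul_of_nonneg_left hRge (exp_pos (σ * (x - 1))).le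
        calc trigamma 0 l 1 =
              exp (σ * (x - 1)) * (trigamma 0 l 1 * exp (-σ * (x - 1))) := by
                linear_combination -trigamma 0 l 1 * hexp
          _ ≤ _ := h2
      · rw [mul_add, ← mul_assoc, hAD, mul_one]
        have := neg_digamma_le_left' hl.le hy0 hy1.le
        rwa [one_div_one_div] at this
      · rw [hAD]
        have := trigamma_add_digamma_antitoneOn hl.le hy0 (mem_Ioi.2 one_pos) hy1.le
        simp only at this
        linarith
  refine lt_of_eq_of_lt ?_ (hgoal.trans_eq ?_)
  · have e : 1 + (x - 1) = x := by ring
    have := digamma_one_neg (c := 0) le_rfl hl.le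
    have hne := this.ne
    rw [e]
    field_simp
    ring
  · have e : 1 + (x - 1) = x := by ring
    rw [e]

end

end QGamma

/-! ### Monotonicity of the power means -/

namespace QGamma

open Real Set Filter Topology

/-- The function `x ψ(x) Γ(x) ^ m`; the sign of the derivative of the power mean at `x` is that
of its increment from `1 / x` to `x`. -/
noncomputable def weightedDigamma (c l m x : ℝ) : ℝ :=
  x * digamma c l x * exp (m * logGamma c l x)

lemma powerMean_comm (m a b : ℝ) : powerMean m a b = powerMean m b a := by
  simp only [powerMean, mul_comm a b, add_comm (a ^ m)]

lemma qGammaMean_one_div (m q x : ℝ) : qGammaMean m q (1 / x) = qGammaMean m q x := by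
  rw [qGammaMean, qGammaMean, one_div_one_div, powerMean_comm]

section

variable {q m : ℝ}

/-- By the symmetry `x ↦ 1 / x` only the interval `(1, ∞)` matters. -/
lemma strictAntiOn_of_strictMonoOn (h : StrictMonoOn (qGammaMean m q) (Ioi 1)) :
    StrictAntiOn (qGammaMean m q) (Ioo 0 1) := by
  intro a ha b hb hab
  rw [← qGammaMean_one_div m q a, ← qGammaMean_one_div m q b]
  refine h ?_ ?_ (one_div_lt_one_div_of_lt ha.1 hab)
  · exact (one_lt_div hb.1).2 hb.2
  · exact (one_lt_div ha.1).2 ha.2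

lemma hasDerivAt_logGamma_one_div (c : ℝ) {l x : ℝ} (hl : 0 ≤ l) (hx : 0 < x) :
    HasDerivAt (fun x => logGamma c l (1 / x)) (-(digamma c l (1 / x) / x ^ 2)) x := by
  have hinv : HasDerivAt (fun s : ℝ => 1 / s) (-(1 / x ^ 2)) x := by
    have := hasDerivAt_inv hx.ne'
    simpa [one_div] using this
  refine ((hasDerivAt_logGamma c hl (by positivity : 0 < 1 / x)).comp x hinv).congr_deriv ?_
  ring

/-- The derivative of the power mean is a positive multiple of an increment of
`weightedDigamma`. -/
lemma exists_hasDerivAt_qGammaMean {c l x : ℝ} (m : ℝ) (hl : 0 ≤ l)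
    (hq : ∀ x, 0 < x → qGamma q x = exp (logGamma c l x)) (hx : 0 < x) :
    ∃ K, 0 < K ∧ HasDerivAt (qGammaMean m q)
      (K * (weightedDigamma c l m x - weightedDigamma c l m (1 / x))) x := by
  have hd1 := hasDerivAt_logGamma c hl hx
  have hd2 := hasDerivAt_logGamma_one_div c hl hx
  have hev : ∀ᶠ s in 𝓝 x, qGammaMean m q s =
      powerMean m (exp (logGamma c l s)) (exp (logGamma c l (1 / s))) := by
    filter_upwards [lt_mem_nhds hx] with s hs
    rw [qGammaMean, hq s hs, hq (1 / s) (by positivity)]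
  by_cases hm : m = 0
  · subst hm
    have e : ∀ s, powerMean 0 (exp (logGamma c l s)) (exp (logGamma c l (1 / s))) =
        exp ((logGamma c l s + logGamma c l (1 / s)) / 2) := by
      intro s
      rw [powerMean, if_pos rfl, ← exp_add, exp_half]
    simp only [e] at hev
    refine ⟨exp ((logGamma c l x + logGamma c l (1 / x)) / 2) / (2 * x), by positivity, ?_⟩
    refine (((hd1.add hd2).div_const 2).exp.congr_of_eventuallyEq hev).congr_deriv ?_
    simp only [weightedDigamma, zero_mul, exp_zero, Pi.add_apply]
    field_simp
    ring
  · have e : ∀ s, powerMean m (exp (logGamma c l s)) (exp (logGamma c l (1 / s))) =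
        ((exp (m * logGamma c l s) + exp (m * logGamma c l (1 / s))) / 2) ^ (1 / m) := by
      intro s
      rw [powerMean, if_neg hm, ← exp_mul, ← exp_mul, mul_comm m, mul_comm m]
    simp only [e] at hev
    set S := (exp (m * logGamma c l x) + exp (m * logGamma c l (1 / x))) / 2 with hS
    have hSpos : 0 < S := by positivity
    refine ⟨S ^ (1 / m - 1) / (2 * x), by positivity, ?_⟩
    have hd := (((hd1.const_mul m).exp.add (hd2.const_mul m).exp).div_const 2).rpow_const
      (p := 1 / m) (Or.inl hSpos.ne')
    refine (hd.congr_of_eventuallyEq hev).congr_deriv ?_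
    simp only [weightedDigamma, Pi.add_apply, ← hS]
    field_simp
    ring

lemma hasDerivAt_qGamma {c l x : ℝ} (hl : 0 ≤ l)
    (hq : ∀ x, 0 < x → qGamma q x = exp (logGamma c l x)) (hx : 0 < x) :
    HasDerivAt (qGamma q) (digamma c l x * qGamma q x) x := by
  have hev : ∀ᶠ s in 𝓝 x, qGamma q s = exp (logGamma c l s) := by
    filter_upwards [lt_mem_nhds hx] with s hs using hq s hs
  refine ((hasDerivAt_logGamma c hl hx).exp.congr_of_eventuallyEq hev).congr_deriv ?_
  rw [hq x hx, mul_comm]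

lemma qDigamma_eq {c l x : ℝ} (hl : 0 ≤ l)
    (hq : ∀ x, 0 < x → qGamma q x = exp (logGamma c l x)) (hx : 0 < x) :
    qDigamma q x = digamma c l x := by
  have h : qGamma q x ≠ 0 := by rw [hq x hx]; positivity
  rw [qDigamma, (hasDerivAt_qGamma hl hq hx).deriv, mul_div_cancel_right₀ _ h]

lemma deriv_qDigamma_eq {c l x : ℝ} (hl : 0 ≤ l)
    (hq : ∀ x, 0 < x → qGamma q x = exp (logGamma c l x)) (hx : 0 < x) :
    deriv (qDigamma q) x = trigamma c l x := by
  have hev : ∀ᶠ s in 𝓝 x, qDigamma q s = digamma c l s := by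
    filter_upwards [lt_mem_nhds hx] with s hs using qDigamma_eq hl hq hs
  exact ((hasDerivAt_digamma c hl hx).congr_of_eventuallyEq hev).deriv

/-- If the derivative criterion holds with exponent `m₀`, the mean of any order `m ≥ m₀` is
strictly increasing on `(1, ∞)`: passing from `m₀` to `m` only helps, as `Γ` is decreasing
wherever `ψ` is negative. -/
lemma strictMonoOn_qGammaMean {c l m₀ : ℝ} (hc : 0 ≤ c) (hl : 0 ≤ l)
    (hq : ∀ x, 0 < x → qGamma q x = exp (logGamma c l x)) (hm : m₀ ≤ m)
    (h : ∀ s, 1 < s → digamma c l s < 0 →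
      2 + m₀ * (s * digamma c l s + 1 / s * digamma c l (1 / s)) <
        s * (trigamma c l s / -digamma c l s) +
          1 / s * (trigamma c l (1 / s) / -digamma c l (1 / s))) :
    StrictMonoOn (qGammaMean m q) (Ioi 1) := by
  have hmono := digamma_strictMonoOn hc hl
  have hW : ∀ x, 1 < x → weightedDigamma c l m (1 / x) < weightedDigamma c l m x := by
    intro x hx
    have hx0 : 0 < x := by linarith
    have hy0 : 0 < 1 / x := by positivity
    have hy1 : 1 / x < 1 := by rw [div_lt_one hx0]; exact hx
    have hy : digamma c l (1 / x) < 0 :=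
      (hmono hy0 (mem_Ioi.2 one_pos) hy1).trans (digamma_one_neg hc hl)
    rcases le_or_gt 0 (digamma c l x) with hψ | hψ
    · have h1 : weightedDigamma c l m (1 / x) < 0 :=
        mul_neg_of_neg_of_pos (mul_neg_of_pos_of_neg hy0 hy) (exp_pos _)
      have h2 : 0 ≤ weightedDigamma c l m x := by unfold weightedDigamma; positivity
      linarith
    · have key := log_lt_log_of_forall hc hl hx hψ h
      have hg : logGamma c l x ≤ logGamma c l (1 / x) :=
        le_of_hasDerivAt_nonpos (hy1.le.trans hx.le)
          (fun u hu => hasDerivAt_logGamma c hl (hy0.trans_le hu.1))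
          (fun u hu => ((hmono (mem_Ioi.2 (hy0.trans hu.1)) (mem_Ioi.2 hx0) hu.2).trans hψ).le)
      have h1 : (m - m₀) * logGamma c l x ≤ (m - m₀) * logGamma c l (1 / x) :=
        mul_le_mul_of_nonneg_left hg (sub_nonneg.2 hm)
      have h2 : log (x * -digamma c l x) + m * logGamma c l x <
          log (1 / x * -digamma c l (1 / x)) + m * logGamma c l (1 / x) := by linarith
      have h3 := exp_lt_exp.2 h2
      rw [exp_add, exp_add, exp_log (mul_pos hx0 (neg_pos.2 hψ)),
        exp_log (mul_pos hy0 (neg_pos.2 hy))] at h3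
      unfold weightedDigamma
      linarith
  have hd : ∀ x, 0 < x → ∃ K, 0 < K ∧ HasDerivAt (qGammaMean m q)
      (K * (weightedDigamma c l m x - weightedDigamma c l m (1 / x))) x :=
    fun x hx => exists_hasDerivAt_qGammaMean m hl hq hx
  choose! K hK hd using hd
  intro a ha b _ hab
  have ha' : (1 : ℝ) < a := ha
  exact lt_of_hasDerivAt_pos hab (fun x hx => hd x (by linarith [hx.1]))
    fun x hx => mul_pos (hK x (by linarith [hx.1])) (sub_pos.2 (hW x (by linarith [hx.1])))

/-- If the mean increases on `(1, ∞)`, the derivative of `weightedDigamma` at `1` is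
nonnegative, which bounds `m` from below. -/
lemma le_of_monotoneOn_qGammaMean {c l : ℝ} (hc : 0 ≤ c) (hl : 0 ≤ l)
    (hq : ∀ x, 0 < x → qGamma q x = exp (logGamma c l x))
    (h : MonotoneOn (qGammaMean m q) (Ioi 1)) :
    (-digamma c l 1 - trigamma c l 1) / digamma c l 1 ^ 2 ≤ m := by
  have hψ := digamma_one_neg hc hl
  set W := weightedDigamma c l m with hWdef
  have hW : ∀ x, 1 < x → 0 ≤ W x - W (1 / x) := by
    intro x hx
    obtain ⟨K, hK, hd⟩ := exists_hasDerivAt_qGammaMean m hl hq (by linarith : 0 < x)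
    have h1 := h.derivWithin_nonneg (x := x)
    rw [derivWithin_of_isOpen isOpen_Ioi hx, hd.deriv] at h1
    exact nonneg_of_mul_nonneg_right h1 hK
  have hWd : HasDerivAt W (digamma c l 1 + trigamma c l 1 + m * digamma c l 1 ^ 2) 1 := by
    have := ((hasDerivAt_id' (1 : ℝ)).mul (hasDerivAt_digamma c hl one_pos)).mul
      (((hasDerivAt_logGamma c hl one_pos).const_mul m).exp)
    refine this.congr_deriv ?_
    simp [logGamma_one]
    ring
  have hinv : HasDerivAt (fun s : ℝ => 1 / s) (-1) 1 := by
    have := hasDerivAt_inv (one_ne_zero : (1 : ℝ) ≠ 0)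
    simpa [one_div] using this
  have hWi : HasDerivAt (fun x => W (1 / x))
      ((digamma c l 1 + trigamma c l 1 + m * digamma c l 1 ^ 2) * -1) 1 := by
    have h1 : HasDerivAt W (digamma c l 1 + trigamma c l 1 + m * digamma c l 1 ^ 2)
        (1 / 1) := by rw [one_div_one]; exact hWd
    exact h1.comp 1 hinv
  have hslope := (hasDerivWithinAt_iff_tendsto_slope' self_notMem_Ioi).1
    ((hWd.sub hWi).hasDerivWithinAt (s := Ioi 1))
  have h0 : 0 ≤ digamma c l 1 + trigamma c l 1 + m * digamma c l 1 ^ 2 -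
      (digamma c l 1 + trigamma c l 1 + m * digamma c l 1 ^ 2) * -1 := by
    refine ge_of_tendsto hslope ?_
    filter_upwards [self_mem_nhdsWithin] with x hx
    have hx' : (1 : ℝ) < x := hx
    rw [slope_def_field]
    refine div_nonneg ?_ (by linarith)
    simpa using hW x hx'
  have h2 : 0 < digamma c l 1 ^ 2 := by
    have := hψ.ne
    positivity
  rw [div_le_iff₀ h2]
  linarith

end

end QGamma

open QGamma in
theorem mainTheorem9 :
    (∀ q : ℝ, 1 ≤ q → ∀ m : ℝ,
      ((AntitoneOn (qGammaMean m q) (Set.Ioo 0 1) ∧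
          MonotoneOn (qGammaMean m q) (Set.Ioi 1)) ↔
        (-qDigamma q 1 - deriv (qDigamma q) 1) / (qDigamma q 1) ^ 2 ≤ m) ∧
      ((StrictAntiOn (qGammaMean m q) (Set.Ioo 0 1) ∧
          StrictMonoOn (qGammaMean m q) (Set.Ioi 1)) ↔
        (-qDigamma q 1 - deriv (qDigamma q) 1) / (qDigamma q 1) ^ 2 ≤ m)) ∧
    (∀ q : ℝ, 0 < q → ∀ m : ℝ, 1 / qDigamma q 1 ≤ m →
      StrictAntiOn (qGammaMean m q) (Set.Ioo 0 1) ∧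
        StrictMonoOn (qGammaMean m q) (Set.Ioi 1)) := by
  have hge : ∀ q : ℝ, 1 ≤ q → ∀ m : ℝ,
      (-qDigamma q 1 - deriv (qDigamma q) 1) / (qDigamma q 1) ^ 2 ≤ m →
      StrictMonoOn (qGammaMean m q) (Set.Ioi 1) := by
    intro q hq m hm
    have hl : 0 ≤ |Real.log q| / 2 := by positivity
    have hG : ∀ x, 0 < x → qGamma q x =
        Real.exp (logGamma (2 * (|Real.log q| / 2)) (|Real.log q| / 2) x) := by
      intro x hx
      have h := Real.log_nonneg hq
      rw [qGamma_eq_exp (by linarith) hx, max_eq_left h, mul_div_cancel₀ _ two_ne_zero,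
        abs_of_nonneg h]
    rw [qDigamma_eq hl hG one_pos, deriv_qDigamma_eq hl hG one_pos] at hm
    exact strictMonoOn_qGammaMean (by positivity) hl hG hm
      fun s hs hψ => criterion_of_one_le hl hs hψ
  have hle : ∀ q : ℝ, 1 ≤ q → ∀ m : ℝ, MonotoneOn (qGammaMean m q) (Set.Ioi 1) →
      (-qDigamma q 1 - deriv (qDigamma q) 1) / (qDigamma q 1) ^ 2 ≤ m := by
    intro q hq m h
    have hl : 0 ≤ |Real.log q| / 2 := by positivity
    have hG := fun x (hx : 0 < x) => qGamma_eq_exp (by linarith : 0 < q) hx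
    rw [qDigamma_eq hl hG one_pos, deriv_qDigamma_eq hl hG one_pos]
    exact le_of_monotoneOn_qGammaMean (le_max_right _ _) hl hG h
  refine ⟨fun q hq m => ⟨⟨fun h => hle q hq m h.2, fun h => ?_⟩,
    ⟨fun h => hle q hq m h.2.monotoneOn, fun h => ?_⟩⟩, fun q hq m hm => ?_⟩
  · have := hge q hq m h
    exact ⟨(strictAntiOn_of_strictMonoOn this).antitoneOn, this.monotoneOn⟩
  · have := hge q hq m h
    exact ⟨strictAntiOn_of_strictMonoOn this, this⟩
  · suffices h : StrictMonoOn (qGammaMean m q) (Set.Ioi 1) from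
      ⟨strictAntiOn_of_strictMonoOn h, h⟩
    have hl : 0 ≤ |Real.log q| / 2 := by positivity
    have hG := fun x (hx : 0 < x) => qGamma_eq_exp hq hx
    have hc : 0 ≤ max (Real.log q) 0 := le_max_right _ _
    rcases le_or_gt 1 q with h1 | h1
    · -- the exponent `1 / ψ 1` exceeds the critical one because `ψ' 1 > -2 ψ 1`
      refine hge q h1 m (le_trans ?_ hm)
      rw [qDigamma_eq hl hG one_pos, deriv_qDigamma_eq hl hG one_pos]
      have hψ := digamma_one_neg hc hl
      have h2 := two_mul_neg_digamma_one_lt hc hl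
      have h3 : 0 < digamma (max (Real.log q) 0) (|Real.log q| / 2) 1 ^ 2 := by
        have := hψ.ne
        positivity
      have e : 1 / digamma (max (Real.log q) 0) (|Real.log q| / 2) 1 =
          digamma (max (Real.log q) 0) (|Real.log q| / 2) 1 /
            digamma (max (Real.log q) 0) (|Real.log q| / 2) 1 ^ 2 := by
        have := hψ.ne
        field_simp
      rw [e, div_le_div_iff_of_pos_right h3]
      linarith
    · have hlog := Real.log_neg hq h1
      rw [qDigamma_eq hl hG one_pos] at hm
      rw [max_eq_right hlog.le] at hm hG
      have hl' : 0 < |Real.log q| / 2 := by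
        have := abs_pos.2 hlog.ne
        positivity
      exact strictMonoOn_qGammaMean le_rfl hl hG hm
        fun s hs hψ => criterion_of_lt_one hl' hs hψ
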